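/- Fix an o-minimal structure on the ordered set $\mathbb{R}$ in which addition is definable. For a definable set $A$, which is a finite disjoint union of cells $C_j$, let $\chi(A)=\sum_j(-1)^{\dim C_j}$ be its (Borel–Moore) Euler characteristic. For a definable set $X\subseteq\mathbb{R}^m$ let $\mathrm{Def}(X)$ be the set of compactly supported functions $X\to\mathbb{R}$ with definable graph. For an integer-valued function $k$ on $X$ with finitely many values and definable level sets put $\int_X k\,d\chi=\sum_{s\in\mathbb{Z}}s\,\chi\{k=s\}$, and for a definable function $h:X\to\mathbb{R}$ put $$\int_X h\,\lfloor d\chi\rfloor=\lim_{n\to\infty}\frac1n\int_X\lfloor nh\rfloor\,d\chi,\qquad \int_X h\,\lceil d\chi\rceil=\lim_{n\to\infty}\frac1n\int_X\lceil nh\rceil\,d\chi .$$ Below, $\int$ stands for either one of these two integrals; whenever an integral is mentioned, it is part of the claim that it exists (the functions $\lfloor nh\rfloor$, respectively $\lceil nh\rceil$, have finitely many values and the limit exists). (1) If $X$ is definable and $\dim X>0$, then $\int_X:\mathrm{Def}(X)\to\mathbb{R}$ is not a homomorphism: there are $f,g\in\mathrm{Def}(X)$ with $f+g\in\mathrm{Def}(X)$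 and $\int_X(f+g)\neq\int_X f+\int_X g$. (2) For example, the functions $1$, $x$ and $1-x$ belong to $\mathrm{Def}([0,1])$, and $\int_{[0,1]}1\,\lfloor d\chi\rfloor=1$, whereas $\int_{[0,1]}x\,\lfloor d\chi\rfloor=\int_{[0,1]}(1-x)\,\lfloor d\chi\rfloor=1$, with sum $2$; likewise $\int_{[0,1]}1\,\lceil d\chi\rceil=1$, whereas $\int_{[0,1]}x\,\lceil d\chi\rceil=\int_{[0,1]}(1-x)\,\lceil d\chi\rceil=0$. (3) The Fubini theorem fails: for every definable $Y$ with $\dim Y>0$ there are a definable set $X$, a definable map $F:X\to Y$ and a function $h\in\mathrm{Def}(X)$ such that $F_*h(y)=\int_{F^{-1}(y)}h$ defines a function $F_*h\in\mathrm{Def}(Y)$, and $\int_X h\neq\int_Y F_*h$. -/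

import Mathlib

open Filter Topology

noncomputable section

/-- A finite union of points and open intervals `(a, b)` with `-∞ ≤ a`, `b ≤ +∞`, as a subset of
`ℝ¹ = (Fin 1 → ℝ)`. -/
def IsFiniteUnionOfIntervals (A : Set (Fin 1 → ℝ)) : Prop :=
  ∃ P : Set (Set (Fin 1 → ℝ)), P.Finite ∧
    (∀ I ∈ P, (∃ a : ℝ, I = {x | x 0 = a}) ∨
      (∃ a b : EReal, I = {x | a < (x 0 : EReal) ∧ (x 0 : EReal) < b})) ∧
    A = ⋃₀ P

/-- An o-minimal structure on the ordered set of real numbers: Boolean algebras of subsets of the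
`ℝⁿ`, closed under products and coordinate projections, containing the diagonals and the order,
whose members in `ℝ¹` are exactly the finite unions of points and intervals. -/
structure OMinimalStructure where
  Definable : ∀ {n : ℕ}, Set (Fin n → ℝ) → Prop
  empty : ∀ n : ℕ, Definable (∅ : Set (Fin n → ℝ))
  compl : ∀ {n : ℕ} {A : Set (Fin n → ℝ)}, Definable A → Definable Aᶜ
  union : ∀ {n : ℕ} {A B : Set (Fin n → ℝ)}, Definable A → Definable B → Definable (A ∪ B)
  prod : ∀ {m n : ℕ} {A : Set (Fin m → ℝ)} {B : Set (Fin n → ℝ)}, Definable A → Definable B →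
    Definable {z : Fin (m + n) → ℝ |
      (fun i => z (Fin.castAdd n i)) ∈ A ∧ (fun j => z (Fin.natAdd m j)) ∈ B}
  proj : ∀ {n : ℕ} {A : Set (Fin (n + 1) → ℝ)}, Definable A →
    Definable ((fun x : Fin (n + 1) → ℝ => fun i : Fin n => x i.castSucc) '' A)
  diag : ∀ {n : ℕ} (i j : Fin n), Definable {x : Fin n → ℝ | x i = x j}
  lt : Definable {x : Fin 2 → ℝ | x 0 < x 1}
  one_dim : ∀ A : Set (Fin 1 → ℝ), Definable A ↔ IsFiniteUnionOfIntervals A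

namespace OMinimalStructure

variable (O : OMinimalStructure)

/-- A map `F : X → ℝᵏ` is definable if its graph is a definable subset of `ℝᵐ × ℝᵏ`. -/
def DefinableMap {m k : ℕ} {X : Set (Fin m → ℝ)} (F : X → (Fin k → ℝ)) : Prop :=
  O.Definable {z : Fin (m + k) → ℝ |
    ∃ h : (fun i => z (Fin.castAdd k i)) ∈ X, (fun j => z (Fin.natAdd m j)) = F ⟨_, h⟩}

/-- A function `h : X → ℝ` is definable if its graph is a definable subset of `ℝᵐ × ℝ`. -/
def DefinableFun {m : ℕ} {X : Set (Fin m → ℝ)} (h : X → ℝ) : Prop :=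
  O.DefinableMap (k := 1) (fun x _ => h x)

/-- The class `Def(X)` of compactly supported definable functions `X → ℝ`. -/
def Def {m : ℕ} (X : Set (Fin m → ℝ)) : Set (X → ℝ) :=
  {h | O.DefinableFun h ∧ HasCompactSupport h}

/-- A possible end of the fibres of a cell over `C`: a continuous definable function on `C`, or one
of the constants `-∞`, `+∞`. -/
def IsCellBound {n : ℕ} {C : Set (Fin n → ℝ)} (φ : C → EReal) : Prop :=
  (φ = fun _ => ⊥) ∨ (φ = fun _ => ⊤) ∨
    ∃ f : C → ℝ, Continuous f ∧ O.DefinableFun f ∧ φ = fun x => (f x : EReal)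

/-- `O.IsCell d C`: the set `C ⊆ ℝⁿ` is a cell of dimension `d`. The cells of `ℝⁿ⁺¹` are the graphs
of continuous definable functions on cells of `ℝⁿ` and the open bands between two such functions
(or `±∞`), starting from the one-point space `ℝ⁰`. -/
inductive IsCell : {n : ℕ} → ℕ → Set (Fin n → ℝ) → Prop
  | point : IsCell 0 (Set.univ : Set (Fin 0 → ℝ))
  | graph {n d : ℕ} {C : Set (Fin n → ℝ)} (hC : IsCell d C) (f : C → ℝ)
      (hf : Continuous f) (hdef : O.DefinableFun f) :
      IsCell d {x : Fin (n + 1) → ℝ |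
        ∃ h : (fun i : Fin n => x i.castSucc) ∈ C, x (Fin.last n) = f ⟨_, h⟩}
  | band {n d : ℕ} {C : Set (Fin n → ℝ)} (hC : IsCell d C) (φ ψ : C → EReal)
      (hφ : O.IsCellBound φ) (hψ : O.IsCellBound ψ) (hlt : ∀ c, φ c < ψ c) :
      IsCell (d + 1) {x : Fin (n + 1) → ℝ |
        ∃ h : (fun i : Fin n => x i.castSucc) ∈ C,
          φ ⟨_, h⟩ < (x (Fin.last n) : EReal) ∧ (x (Fin.last n) : EReal) < ψ ⟨_, h⟩}

/-- The dimension of a definable set: the largest dimension of a cell that it contains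
(`-∞` for the empty set). -/
def dim {n : ℕ} (X : Set (Fin n → ℝ)) : WithBot ℕ∞ :=
  ⨆ (d : ℕ) (_ : ∃ C : Set (Fin n → ℝ), O.IsCell d C ∧ C ⊆ X), (d : WithBot ℕ∞)

/-- `e` is the alternating sum `∑ (-1)^(dim C)` over some finite partition of `A` into cells. -/
def IsEulerSum {n : ℕ} (A : Set (Fin n → ℝ)) (e : ℤ) : Prop :=
  ∃ (k : ℕ) (C : Fin k → Set (Fin n → ℝ)) (d : Fin k → ℕ),
    (∀ j, O.IsCell (d j) (C j)) ∧ Pairwise (Function.onFun Disjoint C) ∧ (⋃ j, C j) = A ∧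
    e = ∑ j, (-1 : ℤ) ^ d j

open Classical in
/-- The geometric (Borel-Moore) Euler characteristic of a definable set, computed from a finite
partition into cells. Every definable set has such a partition, and the value does not depend on
it. -/
def eulerChar {n : ℕ} (A : Set (Fin n → ℝ)) : ℤ :=
  if h : ∃ e, O.IsEulerSum A e then h.choose else 0

/-- The Euler integral `∫_A k dχ = ∑ₛ s χ(A ∩ {k = s})` of an integer-valued function `k` over a
subset `A` of `X`, for `k` with finitely many values on `A`. -/
def constructibleIntegral {m : ℕ} {X : Set (Fin m → ℝ)} (A : Set X) (k : X → ℤ) : ℤ :=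
  ∑ᶠ s : ℤ, s * O.eulerChar (Subtype.val '' {x : X | x ∈ A ∧ k x = s})

/-- The integral of the real-valued function `h` over `A ⊆ X` exists and equals `c`, that is,
`c = lim (1/n) ∫_A r(n h) dχ`. The integral with respect to `⌊dχ⌋` is the case `r = Int.floor`, the
one with respect to `⌈dχ⌉` is the case `r = Int.ceil`. The functions `r(n h)` have to be integrands
of the Euler integral, so to have finitely many values. -/
def HasIntegral (r : ℝ → ℤ) {m : ℕ} {X : Set (Fin m → ℝ)} (A : Set X) (h : X → ℝ) (c : ℝ) : Prop :=
  (∀ n : ℕ, ((fun x => r (n * h x)) '' A).Finite) ∧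
  Tendsto (fun n : ℕ => (1 / (n : ℝ)) * (O.constructibleIntegral A (fun x => r (n * h x)) : ℝ))
    atTop (𝓝 c)

end OMinimalStructure

/-- The interval `[0,1]` as a subset of `ℝ¹`. -/
def unitSegment : Set (Fin 1 → ℝ) := {x | 0 ≤ x 0 ∧ x 0 ≤ 1}

end

/-!
Both failures already occur on an arc. A cell of positive dimension contains an arc `γ`: a curve,
parametrised by one of the coordinates, whose open pieces are one-dimensional cells
(`IsCell.exists_isArc`). All functions used below vanish off a compact piece `γ [p, q]` of such an
arc. The level set of the value `0` does not contribute to an Euler integral, so only subsets of the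
arc matter, and these have explicit partitions into points and open pieces of the arc.

With respect to `⌊dχ⌋` the function `γ t ↦ t - p` has integral `q - p`: the level sets of
`⌊n (t - p)⌋` are half-open pieces of Euler characteristic `0`, except for the last one, which
contains the end `q`. Its negative has integral `0`, because `⌊-n (t - p)⌋ = -⌈n (t - p)⌉`, and the
half-open level sets of `⌈n (t - p)⌉` at the non-zero values do not contribute. The two functions
add up to `0`, so the integral is not additive; for `⌈dχ⌉` the roles are exchanged
(`IsArc.exists_integral_add_ne`). The example on `[0, 1]` is the same computation on an arc in `ℝ¹`.

For the Fubini theorem the arc `γ [c - δ, c + δ]` is folded at its middle. The pushforward of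
`γ t ↦ t - (c - δ)` is `2 δ` on a half-open piece and `δ` at the middle, so that its integral is `δ`,
whereas the function itself has integral `2 δ` or `0` (`IsArc.exists_fubini_ne`).

The Euler characteristic of a set is the alternating sum over some partition into cells, so these
computations need that any two partitions of a set give the same sum. This holds without common
refinements: a linear relation between indicators of cells of `ℝⁿ⁺¹` becomes, after integration over
the fibres of the projection to `ℝⁿ`, the same kind of relation between the indicators of their
bases, and on the line the Euler characteristic is a sum of jumps of the indicator
(`sum_cell_eq_zero`, `eulerChar_eq_sum`).
-/

namespace OMinimalStructure

variable {O : OMinimalStructure}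

/-! ### The Euler characteristic does not depend on the cell decomposition -/

/-- `S ⊆ ℝ` is a point (`ε = 0`) or a non-empty open interval with possibly infinite ends
(`ε = 1`), that is, a cell of `ℝ` of dimension `ε`. -/
def IsLineCell (ε : ℕ) (S : Set ℝ) : Prop :=
  (ε = 0 ∧ ∃ a : ℝ, S = {a}) ∨
    (ε = 1 ∧ ∃ u v : EReal, u < v ∧ S = {t : ℝ | u < (t : EReal) ∧ (t : EReal) < v})

/-- The Euler characteristic of a cell of the line is the sum of the jumps of its indicator
function `1_S`, that is, `∑ₓ (1_S(x) - 1_S(x+)) - 1_S(-∞)`. The one-sided limits are replaced by the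
values at `x + δ` and `-1 / δ` for small `δ > 0`, and the sum may run over any finite set containing
the ends. -/
lemma IsLineCell.exists_jump_formula {ε : ℕ} {S : Set ℝ} (hS : IsLineCell ε S) :
    ∃ E : Finset ℝ, ∀ T : Finset ℝ, E ⊆ T → ∀ᶠ δ in 𝓝[>] (0 : ℝ),
      (-1 : ℤ) ^ ε = ∑ x ∈ T, (S.indicator (1 : ℝ → ℤ) x - S.indicator (1 : ℝ → ℤ) (x + δ))
        - S.indicator (1 : ℝ → ℤ) (-δ⁻¹) := by
  classical
  have hbot : Tendsto (fun δ : ℝ => -δ⁻¹) (𝓝[>] (0 : ℝ)) atBot :=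
    tendsto_neg_atTop_atBot.comp tendsto_inv_nhdsGT_zero
  have hadd : ∀ x : ℝ, Tendsto (fun δ : ℝ => x + δ) (𝓝[>] (0 : ℝ)) (𝓝[>] x) := by
    intro x
    refine tendsto_nhdsWithin_iff.2 ⟨?_, ?_⟩
    · have : Tendsto (fun δ : ℝ => x + δ) (𝓝 (0 : ℝ)) (𝓝 (x + 0)) := by
        apply Continuous.tendsto; fun_prop
      rw [add_zero] at this
      exact this.mono_left nhdsWithin_le_nhds
    · filter_upwards [self_mem_nhdsWithin] with δ hδ
      simpa using hδ
  rcases hS with ⟨rfl, a, rfl⟩ | ⟨rfl, u, v, huv, rfl⟩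
  · refine ⟨{a}, fun T hT => ?_⟩
    have h1 : ∀ x ∈ T, ∀ᶠ δ in 𝓝[>] (0 : ℝ), x + δ ≠ a := by
      intro x _
      rcases eq_or_ne x a with rfl | hx
      · filter_upwards [self_mem_nhdsWithin] with δ hδ
        simpa using (ne_of_gt hδ)
      · exact ((hadd x).mono_right nhdsWithin_le_nhds).eventually_ne hx
    filter_upwards [(Finset.eventually_all T).2 h1, hbot.eventually_lt_atBot a] with δ h2 h3
    have h4 : ∀ x ∈ T, (({a} : Set ℝ).indicator (1 : ℝ → ℤ) x
        - ({a} : Set ℝ).indicator (1 : ℝ → ℤ) (x + δ)) = if x = a then 1 else 0 := by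
      intro x hx
      simp [Set.indicator_apply, h2 x hx]
    rw [Finset.sum_congr rfl h4]
    have : a ∈ T := hT (by simp)
    simp [this, h3.ne]
  · refine ⟨{u.toReal}, fun T hT => ?_⟩
    set S : Set ℝ := {t : ℝ | u < (t : EReal) ∧ (t : EReal) < v} with hSdef
    have h1 : ∀ x ∈ T, ∀ᶠ δ in 𝓝[>] (0 : ℝ), S.indicator (1 : ℝ → ℤ) x
        - S.indicator (1 : ℝ → ℤ) (x + δ) = if (x : EReal) = u then -1 else 0 := by
      intro x _
      have hc : Tendsto (fun δ : ℝ => ((x + δ : ℝ) : EReal)) (𝓝[>] (0 : ℝ)) (𝓝 (x : EReal)) :=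
        (continuous_coe_real_ereal.tendsto x).comp ((hadd x).mono_right nhdsWithin_le_nhds)
      have hgt : ∀ᶠ δ in 𝓝[>] (0 : ℝ), (x : EReal) < ((x + δ : ℝ) : EReal) := by
        filter_upwards [self_mem_nhdsWithin] with δ hδ
        rw [EReal.coe_lt_coe_iff]
        simpa using hδ
      rcases lt_trichotomy (x : EReal) u with hx | hx | hx
      · filter_upwards [hc.eventually_lt_const hx] with δ hδ
        simp [hSdef, -EReal.coe_add, hx.ne, hx.not_gt, hδ.not_gt]
      · filter_upwards [hc.eventually_lt_const (hx ▸ huv), hgt] with δ hδ hδ'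
        rw [hx] at hδ'
        simp only [hSdef, Set.indicator_apply, Set.mem_ofPred_eq, hx, lt_irrefl, hδ, hδ']
        simp
      · rcases lt_or_ge (x : EReal) v with hv | hv
        · filter_upwards [hc.eventually_lt_const hv, hgt] with δ hδ hδ'
          simp [hSdef, -EReal.coe_add, hx, hx.ne', hv, hδ, hx.trans hδ']
        · filter_upwards [hgt] with δ hδ'
          simp [hSdef, -EReal.coe_add, hx.ne', hv.not_gt, (hv.trans hδ'.le).not_gt]
    have h3 : ∀ᶠ δ in 𝓝[>] (0 : ℝ),
        S.indicator (1 : ℝ → ℤ) (-δ⁻¹) = if u = ⊥ then 1 else 0 := by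
      induction u with
      | bot =>
        obtain ⟨w, -, hw⟩ := EReal.lt_iff_exists_real_btwn.1 huv
        filter_upwards [hbot.eventually_lt_atBot w] with δ hδ
        have : ((-δ⁻¹ : ℝ) : EReal) < v := (EReal.coe_lt_coe_iff.2 hδ).trans hw
        simp only [hSdef, Set.indicator_apply, Set.mem_ofPred_eq, this, EReal.bot_lt_coe]
        simp
      | top => exact absurd huv not_top_lt
      | coe u =>
        filter_upwards [hbot.eventually_lt_atBot u] with δ hδ
        have : ¬ (u : EReal) < ((-δ⁻¹ : ℝ) : EReal) := by
          rw [EReal.coe_lt_coe_iff]; exact hδ.not_gt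
        simp only [hSdef, Set.indicator_apply, Set.mem_ofPred_eq, this, EReal.coe_ne_bot]
        simp
    filter_upwards [(Finset.eventually_all T).2 h1, h3] with δ h2 h4
    rw [Finset.sum_congr rfl h2, h4]
    induction u with
    | bot => simp
    | top => exact absurd huv not_top_lt
    | coe u =>
      have : u ∈ T := hT (by simp)
      simp [this]

/-- A linear relation between indicators of cells of the line also holds between their Euler
characteristics. -/
lemma sum_lineCell_eq_zero {ι : Type*} [Fintype ι] (S : ι → Set ℝ) (ε : ι → ℕ) (c : ι → ℤ)
    (hS : ∀ j, c j ≠ 0 → IsLineCell (ε j) (S j))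
    (h0 : ∀ t, ∑ j, c j * (S j).indicator (1 : ℝ → ℤ) t = 0) :
    ∑ j, c j * (-1 : ℤ) ^ ε j = 0 := by
  classical
  have key : ∀ j, ∃ E : Finset ℝ, ∀ T : Finset ℝ, E ⊆ T → ∀ᶠ δ in 𝓝[>] (0 : ℝ),
      c j * (-1 : ℤ) ^ ε j = c j * (∑ x ∈ T, ((S j).indicator (1 : ℝ → ℤ) x
        - (S j).indicator (1 : ℝ → ℤ) (x + δ)) - (S j).indicator (1 : ℝ → ℤ) (-δ⁻¹)) := by
    intro j
    by_cases hj : c j = 0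
    · exact ⟨∅, fun T _ => by simp [hj]⟩
    · obtain ⟨E, hE⟩ := (hS j hj).exists_jump_formula
      exact ⟨E, fun T hT => (hE T hT).mono fun δ hδ => by rw [hδ]⟩
  choose E hE using key
  obtain ⟨δ, hδ⟩ := (eventually_all.2 fun j =>
    hE j (Finset.univ.biUnion E) (Finset.subset_biUnion_of_mem E (Finset.mem_univ j))).exists
  rw [Finset.sum_congr rfl fun j _ => hδ j]
  simp only [mul_sub, Finset.mul_sum, Finset.sum_sub_distrib]
  rw [Finset.sum_comm, Finset.sum_comm (s := Finset.univ)]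
  simp [h0]

/-- The fibres of a cell over its base `B` are cells of the line, all of the same dimension. -/
lemma IsCell.exists_base {d n : ℕ} {C : Set (Fin (n + 1) → ℝ)} (h : O.IsCell d C) :
    ∃ (B : Set (Fin n → ℝ)) (e ε : ℕ), O.IsCell e B ∧ d = e + ε ∧
      (∀ y t, (Fin.snoc y t : Fin (n + 1) → ℝ) ∈ C → y ∈ B) ∧
      ∀ y ∈ B, IsLineCell ε {t | (Fin.snoc y t : Fin (n + 1) → ℝ) ∈ C} := by
  cases h with
  | @graph _ _ B hB f hf hdef =>
    refine ⟨B, d, 0, hB, rfl, ?_, ?_⟩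
    · rintro y t ⟨h, -⟩
      simpa using h
    · intro y hy
      refine Or.inl ⟨rfl, f ⟨y, hy⟩, ?_⟩
      ext t
      simp [hy]
  | @band _ e B hB φ ψ hφ hψ hlt =>
    refine ⟨B, e, 1, hB, rfl, ?_, ?_⟩
    · rintro y t ⟨h, -⟩
      simpa using h
    · intro y hy
      refine Or.inr ⟨rfl, φ ⟨y, hy⟩, ψ ⟨y, hy⟩, hlt _, ?_⟩
      ext t
      simp [hy]

/-- A linear relation between indicators of cells also holds between their Euler characteristics:
integrate it over the fibres of the projection that forgets the last coordinate. -/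
lemma sum_cell_eq_zero {n : ℕ} {ι : Type*} [Fintype ι] (C : ι → Set (Fin n → ℝ)) (d : ι → ℕ)
    (c : ι → ℤ) (hC : ∀ j, O.IsCell (d j) (C j))
    (h0 : ∀ x, ∑ j, c j * (C j).indicator (1 : (Fin n → ℝ) → ℤ) x = 0) :
    ∑ j, c j * (-1 : ℤ) ^ d j = 0 := by
  classical
  induction n generalizing c d with
  | zero =>
    have h : ∀ j, d j = 0 ∧ C j = Set.univ := by
      intro j
      have := hC j
      generalize C j = A at this
      generalize d j = e at this
      cases this
      exact ⟨rfl, rfl⟩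
    simpa [h] using h0 Fin.elim0
  | succ n ih =>
    choose B e ε hB hd hsub hfib using fun j => (hC j).exists_base
    have := ih B e (fun j => c j * (-1 : ℤ) ^ ε j) hB ?_
    · simpa only [hd, pow_add, mul_assoc, mul_comm ((-1 : ℤ) ^ ε _)] using this
    · intro y
      have := sum_lineCell_eq_zero (fun j => {t | (Fin.snoc y t : Fin (n + 1) → ℝ) ∈ C j}) ε
        (fun j => c j * (B j).indicator (1 : (Fin n → ℝ) → ℤ) y) ?_ ?_
      · rw [← this]
        exact Finset.sum_congr rfl fun j _ => by ring
      · intro j hj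
        refine hfib j y ?_
        by_contra h
        simp [h] at hj
      · intro t
        rw [← h0 (Fin.snoc y t)]
        refine Finset.sum_congr rfl fun j _ => ?_
        by_cases h : (Fin.snoc y t : Fin (n + 1) → ℝ) ∈ C j
        · simp [h, hsub j y t h]
        · simp [h]

lemma sum_indicator_partition {α ι : Type*} [Fintype ι] {A : Set α} (D : ι → Set α)
    (hD : Pairwise (Function.onFun Disjoint D)) (hA : ⋃ j, D j = A) (x : α) :
    ∑ j, (D j).indicator (1 : α → ℤ) x = A.indicator 1 x := by
  classical
  subst hA
  by_cases hx : x ∈ ⋃ j, D j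
  · obtain ⟨j, hj⟩ := Set.mem_iUnion.1 hx
    rw [Finset.sum_eq_single j, Set.indicator_of_mem hx, Set.indicator_of_mem hj]
    · intro i _ hij
      exact Set.indicator_of_notMem (fun hi => (Set.disjoint_left.1 (hD hij)) hi hj) _
    · simp
  · rw [Set.indicator_of_notMem hx]
    exact Finset.sum_eq_zero fun j _ =>
      Set.indicator_of_notMem (fun hj => hx (Set.mem_iUnion.2 ⟨j, hj⟩)) _

/-- The Euler characteristic may be computed from any finite partition into cells. -/
lemma eulerChar_eq_sum {n : ℕ} {ι : Type*} [Fintype ι] {A : Set (Fin n → ℝ)}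
    (C : ι → Set (Fin n → ℝ)) (d : ι → ℕ) (hC : ∀ j, O.IsCell (d j) (C j))
    (hdisj : Pairwise (Function.onFun Disjoint C)) (hA : ⋃ j, C j = A) :
    O.eulerChar A = ∑ j, (-1 : ℤ) ^ d j := by
  classical
  have hex : ∃ e, O.IsEulerSum A e := by
    let σ := (Fintype.equivFin ι).symm
    refine ⟨_, Fintype.card ι, C ∘ σ, d ∘ σ, fun j => hC _, ?_, ?_, rfl⟩
    · exact fun i j hij => hdisj (σ.injective.ne hij)
    · rw [← hA]
      exact σ.surjective.iUnion_comp C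
  rw [eulerChar, dif_pos hex]
  obtain ⟨k, C', d', hC', hdisj', hA', he⟩ := hex.choose_spec
  rw [he]
  -- the two partitions give two expressions for the indicator of `A`
  have h1 := sum_indicator_partition C hdisj hA
  have h2 := sum_indicator_partition C' hdisj' hA'
  have := sum_cell_eq_zero (O := O) (ι := Fin k ⊕ ι) (Sum.elim C' C) (Sum.elim d' d)
    (Sum.elim (fun _ => 1) (fun _ => -1)) (by rintro (j | j); exacts [hC' j, hC j]) ?_
  · simp [Fintype.sum_sum_type] at this
    linarith
  · intro x
    simp [Fintype.sum_sum_type, h1, h2]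

/-- If `k` is constant on each of finitely many disjoint cells in `A` and vanishes on the rest of
`A`, then its Euler integral over `A` is the sum of the values on the cells `C`, each weighted with
`(-1) ^ dim C`. -/
lemma constructibleIntegral_eq_sum {m : ℕ} {X : Set (Fin m → ℝ)} {ι : Type*} [Fintype ι]
    (A : Set X) (k : X → ℤ) (C : ι → Set (Fin m → ℝ)) (d : ι → ℕ) (v : ι → ℤ)
    (hC : ∀ j, O.IsCell (d j) (C j)) (hdisj : Pairwise (Function.onFun Disjoint C))
    (hv : ∀ j, ∀ x ∈ C j, ∃ h : x ∈ X, (⟨x, h⟩ : X) ∈ A ∧ k ⟨x, h⟩ = v j)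
    (hcov : ∀ x ∈ A, k x ≠ 0 → ∃ j, x.1 ∈ C j) :
    O.constructibleIntegral A k = ∑ j, v j * (-1 : ℤ) ^ d j := by
  classical
  have key : ∀ s : ℤ, s * O.eulerChar (Subtype.val '' {x : X | x ∈ A ∧ k x = s})
      = s * ∑ j, if v j = s then (-1 : ℤ) ^ d j else 0 := by
    intro s
    rcases eq_or_ne s 0 with rfl | hs
    · simp
    congr 1
    rw [eulerChar_eq_sum (ι := {j // v j = s}) (fun j => C j) (fun j => d j) (fun j => hC j)
      (fun i j hij => hdisj (Subtype.val_injective.ne hij)), ← Finset.sum_filter]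
    · exact (Finset.sum_subtype (Finset.univ.filter fun j => v j = s)
        (fun j => Finset.mem_filter_univ j) fun j => (-1 : ℤ) ^ d j).symm
    · ext x
      simp only [Set.mem_iUnion, Set.mem_image, Set.mem_ofPred_eq]
      constructor
      · rintro ⟨⟨j, hj⟩, hx⟩
        obtain ⟨h, hA, hk⟩ := hv j x hx
        exact ⟨⟨x, h⟩, ⟨hA, hk.trans hj⟩, rfl⟩
      · rintro ⟨x, ⟨hA, hk⟩, rfl⟩
        obtain ⟨j, hj⟩ := hcov x hA (hk.trans_ne hs)
        obtain ⟨h, -, hk'⟩ := hv j x hj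
        exact ⟨⟨j, hk'.symm.trans hk⟩, hj⟩
  rw [constructibleIntegral, finsum_congr key,
    finsum_eq_sum_of_support_subset (s := Finset.univ.image v)]
  · simp only [Finset.mul_sum]
    rw [Finset.sum_comm]
    refine Finset.sum_congr rfl fun j _ => ?_
    rw [Finset.sum_eq_single (v j)]
    · simp
    · intro s _ hs
      simp [hs.symm]
    · simp
  · intro s hs
    simp only [Function.mem_support, ne_eq, mul_eq_zero, not_or] at hs
    obtain ⟨j, -, hj⟩ := Finset.exists_ne_zero_of_sum_ne_zero hs.2
    simp only [Finset.coe_image, Finset.coe_univ, Set.image_univ, Set.mem_range]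
    exact ⟨j, by by_contra h; simp [h] at hj⟩

/-! ### Definable sets -/

lemma Definable.inter {n : ℕ} {A B : Set (Fin n → ℝ)} (hA : O.Definable A) (hB : O.Definable B) :
    O.Definable (A ∩ B) := by
  rw [← compl_compl (A ∩ B), Set.compl_inter]
  exact O.compl (O.union (O.compl hA) (O.compl hB))

lemma definable_univ (n : ℕ) : O.Definable (Set.univ : Set (Fin n → ℝ)) := by
  rw [← Set.compl_empty]
  exact O.compl (O.empty n)

lemma definable_iInter {n k : ℕ} (A : Fin k → Set (Fin n → ℝ)) (hA : ∀ j, O.Definable (A j)) :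
    O.Definable (⋂ j, A j) := by
  induction k with
  | zero => simpa using O.definable_univ n
  | succ k ih =>
    have : (⋂ j, A j) = A 0 ∩ ⋂ j : Fin k, A j.succ := by
      ext x; simp [Fin.forall_fin_succ]
    rw [this]
    exact Definable.inter (hA 0) (ih _ fun j => hA _)

lemma definable_image_castAdd {m : ℕ} (k : ℕ) {A : Set (Fin (m + k) → ℝ)} (hA : O.Definable A) :
    O.Definable ((fun x : Fin (m + k) → ℝ => fun i : Fin m => x (Fin.castAdd k i)) '' A) := by
  induction k with
  | zero => simpa using hA
  | succ k ih =>
    have := ih (O.proj (n := m + k) hA)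
    rwa [Set.image_image] at this

/-- Definable sets pull back under coordinate maps: `{x | x ∘ σ ∈ A}` is a projection of the product
`ℝᵐ × A` cut with diagonals. -/
lemma Definable.preimage_comp {m k : ℕ} (σ : Fin k → Fin m) {A : Set (Fin k → ℝ)}
    (hA : O.Definable A) : O.Definable {x : Fin m → ℝ | (fun j => x (σ j)) ∈ A} := by
  have h1 := O.prod (O.definable_univ m) hA
  have h2 := Definable.inter h1 (definable_iInter _
    fun j : Fin k => O.diag (Fin.natAdd m j) (Fin.castAdd k (σ j)))
  convert definable_image_castAdd k h2 using 1
  ext x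
  simp only [Set.mem_ofPred_eq, Set.mem_image, Set.mem_inter_iff, Set.mem_iInter, Set.mem_univ,
    true_and]
  constructor
  · intro hx
    refine ⟨Fin.append x fun j => x (σ j), ⟨?_, ?_⟩, ?_⟩
    · simpa using hx
    · simp
    · simp
  · rintro ⟨z, ⟨hz, hd⟩, rfl⟩
    simpa only [← hd] using hz

lemma definable_coord_eq {n : ℕ} (i : Fin n) (a : ℝ) : O.Definable {x : Fin n → ℝ | x i = a} :=
  Definable.preimage_comp (fun _ : Fin 1 => i) ((O.one_dim {x | x 0 = a}).2
    ⟨{{x | x 0 = a}}, Set.finite_singleton _, by rintro I rfl; exact Or.inl ⟨a, rfl⟩, by simp⟩)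

lemma definable_coord_Ioo {n : ℕ} (i : Fin n) (a b : EReal) :
    O.Definable {x : Fin n → ℝ | a < (x i : EReal) ∧ (x i : EReal) < b} :=
  Definable.preimage_comp (fun _ : Fin 1 => i)
    ((O.one_dim {x | a < (x 0 : EReal) ∧ (x 0 : EReal) < b}).2
      ⟨{{x | a < (x 0 : EReal) ∧ (x 0 : EReal) < b}}, Set.finite_singleton _,
        by rintro I rfl; exact Or.inr ⟨a, b, rfl⟩, by simp⟩)

lemma definable_coord_lt {n : ℕ} (i : Fin n) (b : ℝ) : O.Definable {x : Fin n → ℝ | x i < b} := by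
  simpa using O.definable_coord_Ioo i ⊥ (b : EReal)

lemma definable_lt_coord {n : ℕ} (i : Fin n) (a : ℝ) : O.Definable {x : Fin n → ℝ | a < x i} := by
  simpa using O.definable_coord_Ioo i (a : EReal) ⊤

lemma definable_coord_Icc {n : ℕ} (i : Fin n) (a b : ℝ) :
    O.Definable {x : Fin n → ℝ | x i ∈ Set.Icc a b} := by
  convert Definable.inter (O.compl (definable_coord_lt i a)) (O.compl (definable_lt_coord i b))
    using 1
  ext x
  simp

lemma definable_singleton {n : ℕ} (c : Fin n → ℝ) : O.Definable {c} := by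
  convert definable_iInter (O := O) (fun i => {x : Fin n → ℝ | x i = c i})
    (fun i => definable_coord_eq i (c i)) using 1
  ext x
  simp [funext_iff]

lemma definable_coord_eq_add (hadd : O.Definable {x : Fin 3 → ℝ | x 0 + x 1 = x 2})
    {n : ℕ} (i j : Fin n) (a : ℝ) : O.Definable {x : Fin n → ℝ | x j + a = x i} := by
  have h1 : O.Definable {x : Fin 3 → ℝ | x 1 + x 2 = x 0} :=
    Definable.preimage_comp (![1, 2, 0] : Fin 3 → Fin 3) hadd
  have h := Definable.preimage_comp (![i, j] : Fin 2 → Fin n)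
    (O.proj (Definable.inter h1 (definable_coord_eq 2 a)))
  convert h using 1
  ext x
  simp only [Set.mem_ofPred_eq, Set.mem_image, Set.mem_inter_iff]
  constructor
  · intro hx
    exact ⟨![x i, x j, a], ⟨hx, rfl⟩, by ext l; fin_cases l <;> rfl⟩
  · rintro ⟨z, ⟨h1, h2⟩, hz⟩
    have e0 : z 0 = x i := congrFun hz 0
    have e1 : z 1 = x j := congrFun hz 1
    rw [← e0, ← e1, ← h2, h1]

lemma definable_coord_add_eq (hadd : O.Definable {x : Fin 3 → ℝ | x 0 + x 1 = x 2})
    {n : ℕ} (i j : Fin n) (a : ℝ) : O.Definable {x : Fin n → ℝ | x i + x j = a} := by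
  have h := Definable.preimage_comp (![i, j] : Fin 2 → Fin n)
    (O.proj (Definable.inter hadd (definable_coord_eq 2 a)))
  convert h using 1
  ext x
  simp only [Set.mem_ofPred_eq, Set.mem_image, Set.mem_inter_iff]
  constructor
  · intro hx
    exact ⟨![x i, x j, a], ⟨hx, rfl⟩, by ext l; fin_cases l <;> rfl⟩
  · rintro ⟨z, ⟨h1, h2⟩, hz⟩
    have e0 : z 0 = x i := congrFun hz 0
    have e1 : z 1 = x j := congrFun hz 1
    rw [← e0, ← e1, h1, h2]

lemma definableFun_iff {m : ℕ} {X : Set (Fin m → ℝ)} {h : X → ℝ} :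
    O.DefinableFun h ↔ O.Definable {x : Fin (m + 1) → ℝ |
      ∃ hx : (fun i : Fin m => x i.castSucc) ∈ X, x (Fin.last m) = h ⟨_, hx⟩} := by
  unfold DefinableFun DefinableMap
  apply iff_of_eq
  congr 1
  ext x
  simp only [Set.mem_ofPred_eq, funext_iff, Fin.forall_fin_one]
  rfl

/-! ### Arcs in cells -/

/-- A parametrised arc in `ℝⁿ`: a curve `γ : (a, b) → ℝⁿ`, parametrised by its `i`-th coordinate,
that maps the open subintervals to definable one-dimensional cells. -/
structure IsArc (O : OMinimalStructure) {n : ℕ} (γ : ℝ → Fin n → ℝ) (i : Fin n) (a b : ℝ) :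
    Prop where
  lt : a < b
  coord : ∀ t ∈ Set.Ioo a b, γ t i = t
  continuousOn : ContinuousOn γ (Set.Ioo a b)
  isCell : ∀ u v, a ≤ u → u < v → v ≤ b → O.IsCell 1 (γ '' Set.Ioo u v)
  definable : ∀ u v, a ≤ u → u < v → v ≤ b → O.Definable (γ '' Set.Ioo u v)

lemma IsCell.nonempty {n d : ℕ} {C : Set (Fin n → ℝ)} (hC : O.IsCell d C) : C.Nonempty := by
  induction hC with
  | point => exact ⟨Fin.elim0, trivial⟩
  | graph hC f hf hdef ih =>
    obtain ⟨c, hc⟩ := ih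
    exact ⟨Fin.snoc c (f ⟨c, hc⟩), by simp [hc]⟩
  | band hC φ ψ hφ hψ hlt ih =>
    obtain ⟨c, hc⟩ := ih
    obtain ⟨w, hw⟩ := EReal.lt_iff_exists_real_btwn.1 (hlt ⟨c, hc⟩)
    exact ⟨Fin.snoc c w, by simpa [hc] using hw⟩

lemma definableFun_const_singleton {n : ℕ} (c : Fin n → ℝ) (u : ℝ) :
    O.DefinableFun (fun _ : ({c} : Set (Fin n → ℝ)) => u) := by
  rw [definableFun_iff]
  convert definable_singleton (O := O) (Fin.snoc c u : Fin (n + 1) → ℝ) using 1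
  ext x
  simp [funext_iff, Fin.forall_fin_succ']

lemma isCell_singleton {n : ℕ} (c : Fin n → ℝ) : O.IsCell 0 {c} := by
  induction n with
  | zero =>
    rw [Set.eq_univ_of_forall (s := {c}) fun x => Subsingleton.elim _ _]
    exact IsCell.point
  | succ n ih =>
    convert IsCell.graph (ih fun i => c i.castSucc) (fun _ => c (Fin.last n)) continuous_const
      (definableFun_const_singleton _ _) using 1
    ext x
    simp [funext_iff, Fin.forall_fin_succ']

lemma isCellBound_const_singleton {n : ℕ} (c : Fin n → ℝ) (u : ℝ) :
    O.IsCellBound (fun _ : ({c} : Set (Fin n → ℝ)) => (u : EReal)) :=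
  Or.inr (Or.inr ⟨fun _ => u, continuous_const, definableFun_const_singleton c u, rfl⟩)

lemma isArc_snoc {n : ℕ} (c : Fin n → ℝ) {a b : ℝ} (hab : a < b) :
    O.IsArc (fun t => (Fin.snoc c t : Fin (n + 1) → ℝ)) (Fin.last n) a b where
  lt := hab
  coord t _ := by simp
  continuousOn := by
    refine Continuous.continuousOn (continuous_pi fun i => ?_)
    induction i using Fin.lastCases with
    | last => simpa using continuous_id'
    | cast i => simpa using continuous_const
  isCell u v _ huv _ := by
    convert IsCell.band (isCell_singleton c) (fun _ => (u : EReal)) (fun _ => (v : EReal))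
      (isCellBound_const_singleton c u) (isCellBound_const_singleton c v)
      (fun _ => EReal.coe_lt_coe_iff.2 huv) using 1
    ext x
    simp only [Set.mem_image, Set.mem_Ioo, funext_iff, Fin.forall_fin_succ', Fin.snoc_castSucc,
      Fin.snoc_last, Set.mem_singleton_iff, EReal.coe_lt_coe_iff, Set.mem_ofPred_eq, exists_prop]
    constructor
    · rintro ⟨t, ht, h1, rfl⟩
      exact ⟨fun i => (h1 i).symm, ht⟩
    · rintro ⟨h1, h2⟩
      exact ⟨_, h2, fun i => (h1 i).symm, rfl⟩
  definable u v _ _ _ := by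
    convert Definable.inter (definable_iInter (O := O)
      (fun i : Fin n => {x : Fin (n + 1) → ℝ | x i.castSucc = c i})
      fun i => definable_coord_eq i.castSucc (c i)) (definable_coord_Ioo (Fin.last n) u v) using 1
    ext x
    simp only [Set.mem_image, Set.mem_Ioo, funext_iff, Fin.forall_fin_succ', Fin.snoc_castSucc,
      Fin.snoc_last, EReal.coe_lt_coe_iff, Set.mem_ofPred_eq, Set.mem_inter_iff, Set.mem_iInter]
    constructor
    · rintro ⟨t, ht, h1, rfl⟩
      exact ⟨fun i => (h1 i).symm, ht⟩
    · rintro ⟨h1, h2⟩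
      exact ⟨_, h2, fun i => (h1 i).symm, rfl⟩

/-- An arc in the base of a graph lifts to an arc in the graph. -/
lemma IsArc.lift {n : ℕ} {γ : ℝ → Fin n → ℝ} {i : Fin n} {a b : ℝ} (hγ : O.IsArc γ i a b)
    {C : Set (Fin n → ℝ)} (hC : γ '' Set.Ioo a b ⊆ C) {f : C → ℝ} (hf : Continuous f)
    (hdef : O.DefinableFun f) {g : (Fin n → ℝ) → ℝ} (hg : ∀ x : C, g x = f x) :
    O.IsArc (fun t => (Fin.snoc (γ t) (g (γ t)) : Fin (n + 1) → ℝ)) i.castSucc a b := by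
  have himage : ∀ u v,
      (fun t => (Fin.snoc (γ t) (g (γ t)) : Fin (n + 1) → ℝ)) '' Set.Ioo u v =
      {x | ∃ h : (fun j : Fin n => x j.castSucc) ∈ γ '' Set.Ioo u v,
        x (Fin.last n) = g (fun j : Fin n => x j.castSucc)} := by
    intro u v
    ext x
    simp only [Set.mem_image, Set.mem_ofPred_eq, exists_prop]
    constructor
    · rintro ⟨t, ht, rfl⟩
      exact ⟨⟨t, ht, by simp⟩, by simp⟩
    · rintro ⟨⟨t, ht, h1⟩, h2⟩
      refine ⟨t, ht, ?_⟩
      rw [h1, ← h2]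
      exact Fin.snoc_init_self x
  have hmem : ∀ u v, a ≤ u → v ≤ b → γ '' Set.Ioo u v ⊆ C := fun u v hu hv =>
    (Set.image_mono (Set.Ioo_subset_Ioo hu hv)).trans hC
  have hgc : ContinuousOn g C := by
    rw [continuousOn_iff_continuous_domRestrict]
    exact hf.congr fun x => (hg x).symm
  have hgdef : ∀ u v, a ≤ u → u < v → v ≤ b → O.Definable
      {x : Fin (n + 1) → ℝ | ∃ h : (fun j : Fin n => x j.castSucc) ∈ γ '' Set.Ioo u v,
        x (Fin.last n) = g (fun j : Fin n => x j.castSucc)} := by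
    intro u v hu huv hv
    convert Definable.inter (definableFun_iff.1 hdef)
      ((hγ.definable u v hu huv hv).preimage_comp Fin.castSucc) using 1
    ext x
    simp only [Set.mem_ofPred_eq, Set.mem_inter_iff, exists_prop]
    constructor
    · rintro ⟨h1, h2⟩
      exact ⟨⟨hmem u v hu hv h1, h2.trans (hg ⟨_, hmem u v hu hv h1⟩)⟩, h1⟩
    · rintro ⟨⟨h1, h2⟩, h3⟩
      exact ⟨h3, h2.trans (hg ⟨_, h1⟩).symm⟩
  refine ⟨hγ.lt, fun t ht => by simpa using hγ.coord t ht, ?_, ?_, ?_⟩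
  · have h1 : ContinuousOn (fun t => g (γ t)) (Set.Ioo a b) :=
      hgc.comp hγ.continuousOn fun t ht => hC (Set.mem_image_of_mem γ ht)
    refine continuousOn_pi.2 fun j => ?_
    induction j using Fin.lastCases with
    | last => simpa using h1
    | cast j => simpa using continuousOn_pi.1 hγ.continuousOn j
  · intro u v hu huv hv
    rw [himage u v]
    exact IsCell.graph (hγ.isCell u v hu huv hv) (fun x => g x)
      (continuousOn_iff_continuous_domRestrict.1 (hgc.mono (hmem u v hu hv)))
      (definableFun_iff.2 (hgdef u v hu huv hv))
  · intro u v hu huv hv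
    rw [himage u v]
    exact hgdef u v hu huv hv

/-- A cell of positive dimension contains an arc: a band contains a vertical segment, and the arcs
of a base lift to its graphs. -/
lemma IsCell.exists_isArc {n d : ℕ} {C : Set (Fin n → ℝ)} (hC : O.IsCell d C) (hd : 0 < d) :
    ∃ (γ : ℝ → Fin n → ℝ) (i : Fin n) (a b : ℝ), O.IsArc γ i a b ∧ γ '' Set.Ioo a b ⊆ C := by
  classical
  induction hC with
  | point => exact absurd hd (lt_irrefl 0)
  | @graph n d C hC f hf hdef ih =>
    obtain ⟨γ, i, a, b, hγ, hsub⟩ := ih hd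
    let g : (Fin n → ℝ) → ℝ := fun x => if h : x ∈ C then f ⟨x, h⟩ else 0
    have hg : ∀ x : C, g x = f x := fun x => by simp [g]
    refine ⟨_, i.castSucc, a, b, hγ.lift hsub hf hdef hg, ?_⟩
    rintro _ ⟨t, ht, rfl⟩
    have := hsub (Set.mem_image_of_mem γ ht)
    simp [this, g]
  | @band n d C hC φ ψ hφ hψ hlt ih =>
    obtain ⟨c, hc⟩ := hC.nonempty
    obtain ⟨b, hb1, hb2⟩ := EReal.lt_iff_exists_real_btwn.1 (hlt ⟨c, hc⟩)
    obtain ⟨a, ha1, ha2⟩ := EReal.lt_iff_exists_real_btwn.1 hb1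
    refine ⟨_, Fin.last n, a, b, isArc_snoc c (EReal.coe_lt_coe_iff.1 ha2), ?_⟩
    rintro _ ⟨t, ht, rfl⟩
    simp only [Set.mem_ofPred_eq, Fin.snoc_castSucc, Fin.snoc_last]
    exact ⟨hc, ha1.trans (EReal.coe_lt_coe_iff.2 ht.1), (EReal.coe_lt_coe_iff.2 ht.2).trans hb2⟩

lemma exists_isArc_of_dim_pos {n : ℕ} {X : Set (Fin n → ℝ)} (hX : 0 < O.dim X) :
    ∃ (γ : ℝ → Fin n → ℝ) (i : Fin n) (a b : ℝ), O.IsArc γ i a b ∧ γ '' Set.Ioo a b ⊆ X := by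
  simp only [dim, lt_iSup_iff] at hX
  obtain ⟨d, ⟨C, hC, hCX⟩, hd⟩ := hX
  obtain ⟨γ, i, a, b, hγ, hsub⟩ := hC.exists_isArc (by exact_mod_cast hd)
  exact ⟨γ, i, a, b, hγ, hsub.trans hCX⟩

/-! ### Functions supported on an arc -/

section Arc

variable {n : ℕ} {γ : ℝ → Fin n → ℝ} {i : Fin n} {a b p q : ℝ} {X : Set (Fin n → ℝ)}

lemma Icc_subset_Ioo_of_lt (hap : a < p) (hqb : q < b) : Set.Icc p q ⊆ Set.Ioo a b :=
  fun _ ht => ⟨hap.trans_le ht.1, ht.2.trans_lt hqb⟩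

lemma IsArc.injOn (hγ : O.IsArc γ i a b) : Set.InjOn γ (Set.Ioo a b) := by
  intro s hs t ht h
  rw [← hγ.coord s hs, ← hγ.coord t ht, h]

lemma IsArc.image_Icc (hγ : O.IsArc γ i a b) (hap : a < p) (hqb : q < b) :
    γ '' Set.Icc p q = γ '' Set.Ioo a b ∩ {x | x i ∈ Set.Icc p q} := by
  have h := Icc_subset_Ioo_of_lt hap hqb
  ext x
  constructor
  · rintro ⟨t, ht, rfl⟩
    refine ⟨⟨t, h ht, rfl⟩, ?_⟩
    rw [Set.mem_ofPred_eq, hγ.coord t (h ht)]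
    exact ht
  · rintro ⟨⟨t, ht, rfl⟩, hx⟩
    rw [Set.mem_ofPred_eq, hγ.coord t ht] at hx
    exact ⟨t, hx, rfl⟩

lemma IsArc.definable_image_Icc (hγ : O.IsArc γ i a b) (hap : a < p) (hqb : q < b) :
    O.Definable (γ '' Set.Icc p q) := by
  rw [hγ.image_Icc hap hqb]
  exact Definable.inter (hγ.definable a b le_rfl hγ.lt le_rfl) (definable_coord_Icc i p q)

open Classical in
/-- The function on `X` that takes the value `φ t` at the point `γ t` for `t ∈ [p, q]` and vanishes
off the arc `γ [p, q]`; the parameter `t` is read off as the `i`-th coordinate of the point. -/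
noncomputable def arcFun (X : Set (Fin n → ℝ)) (γ : ℝ → Fin n → ℝ) (i : Fin n) (p q : ℝ)
    (φ : ℝ → ℝ) : X → ℝ :=
  fun x => if x.1 ∈ γ '' Set.Icc p q then φ (x.1 i) else 0

lemma IsArc.arcFun_apply (hγ : O.IsArc γ i a b) (hap : a < p) (hqb : q < b) (φ : ℝ → ℝ) {x : X}
    {t : ℝ} (ht : t ∈ Set.Icc p q) (hx : x.1 = γ t) : arcFun X γ i p q φ x = φ t := by
  rw [arcFun, if_pos ⟨t, ht, hx.symm⟩, hx, hγ.coord t (Icc_subset_Ioo_of_lt hap hqb ht)]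

lemma arcFun_of_notMem (φ : ℝ → ℝ) {x : X} (hx : x.1 ∉ γ '' Set.Icc p q) :
    arcFun X γ i p q φ x = 0 :=
  if_neg hx

lemma IsArc.abs_arcFun_le (hγ : O.IsArc γ i a b) (hap : a < p) (hqb : q < b) {φ : ℝ → ℝ} {B : ℝ}
    (hB : 0 ≤ B) (hφ : ∀ t ∈ Set.Icc p q, |φ t| ≤ B) (x : X) : |arcFun X γ i p q φ x| ≤ B := by
  by_cases hx : x.1 ∈ γ '' Set.Icc p q
  · obtain ⟨t, ht, hx⟩ := hx
    rw [hγ.arcFun_apply hap hqb φ ht hx.symm]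
    exact hφ t ht
  · rw [arcFun_of_notMem φ hx]
    simpa using hB

lemma IsArc.arcFun_mem_Def (hγ : O.IsArc γ i a b) (hap : a < p) (hqb : q < b) (hX : O.Definable X)
    (hsub : γ '' Set.Icc p q ⊆ X) {φ : ℝ → ℝ}
    (hφ : O.Definable {v : Fin 2 → ℝ | v 0 ∈ Set.Icc p q ∧ v 1 = φ (v 0)}) :
    arcFun X γ i p q φ ∈ O.Def X := by
  have hI := hγ.definable_image_Icc hap hqb
  constructor
  · rw [definableFun_iff]
    have h1 := Definable.inter (hI.preimage_comp Fin.castSucc)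
      (hφ.preimage_comp ![i.castSucc, Fin.last n])
    have h2 := Definable.inter (Definable.inter (hX.preimage_comp Fin.castSucc)
      ((O.compl hI).preimage_comp Fin.castSucc)) (definable_coord_eq (Fin.last n) 0)
    convert O.union h1 h2 using 1
    ext z
    simp only [Set.mem_ofPred_eq, Set.mem_union, Set.mem_inter_iff, Set.mem_compl_iff,
      Matrix.cons_val_zero, Matrix.cons_val_one]
    constructor
    · rintro ⟨hx, hz⟩
      by_cases h : (fun j : Fin n => z j.castSucc) ∈ γ '' Set.Icc p q
      · rw [arcFun, if_pos h] at hz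
        have h' := h
        rw [hγ.image_Icc hap hqb] at h'
        exact Or.inl ⟨h, h'.2, hz⟩
      · rw [arcFun_of_notMem φ h] at hz
        exact Or.inr ⟨⟨hx, h⟩, hz⟩
    · rintro (⟨h, -, hz⟩ | ⟨⟨hx, h⟩, hz⟩)
      · refine ⟨hsub h, ?_⟩
        rw [arcFun, if_pos h, hz]
      · refine ⟨hx, ?_⟩
        rw [arcFun_of_notMem φ h, hz]
  · have hK : IsCompact (Subtype.val ⁻¹' (γ '' Set.Icc p q) : Set X) := by
      rw [Subtype.isCompact_iff, Subtype.image_preimage_coe, Set.inter_eq_right.2 hsub]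
      exact isCompact_Icc.image_of_continuousOn
        (hγ.continuousOn.mono (Icc_subset_Ioo_of_lt hap hqb))
    refine HasCompactSupport.of_support_subset_isCompact hK fun x hx => ?_
    by_contra h
    exact hx (arcFun_of_notMem φ h)

/-- The Euler integral of a function supported on the arc `γ [p, q]`, from a subdivision
`p = x₀ < ⋯ < x_M = q` such that the function is constant on the open pieces. -/
lemma IsArc.constructibleIntegral_eq (hγ : O.IsArc γ i a b) (hap : a < p) (hqb : q < b)
    (hsub : γ '' Set.Icc p q ⊆ X) {k : X → ℤ} {K : ℝ → ℤ}
    (hk : ∀ x : X, ∀ t ∈ Set.Icc p q, x.1 = γ t → k x = K t)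
    (hk0 : ∀ x : X, x.1 ∉ γ '' Set.Icc p q → k x = 0)
    {M : ℕ} {x : ℕ → ℝ} (hx0 : x 0 = p) (hxM : x M = q) (hx : StrictMonoOn x (Set.Iic M))
    {w : ℕ → ℤ} (hw : ∀ s < M, ∀ t ∈ Set.Ioo (x s) (x (s + 1)), K t = w s) :
    O.constructibleIntegral Set.univ k
      = ∑ s ∈ Finset.range (M + 1), K (x s) - ∑ s ∈ Finset.range M, w s := by
  have hIcc := Icc_subset_Ioo_of_lt hap hqb
  have hmem : ∀ s ≤ M, x s ∈ Set.Icc p q := fun s hs =>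
    ⟨hx0 ▸ hx.monotoneOn (Nat.zero_le M) hs (Nat.zero_le s),
      hxM ▸ hx.monotoneOn hs (Set.mem_Iic.2 le_rfl) hs⟩
  let S : Fin (M + 1) ⊕ Fin M → Set ℝ :=
    Sum.elim (fun s => {x s}) (fun s => Set.Ioo (x s) (x (s + 1)))
  have hSI : ∀ j, S j ⊆ Set.Icc p q := by
    rintro (s | s) t ht
    · rw [show t = x s from ht]
      exact hmem s (by lia)
    · exact ⟨(hmem s (by lia)).1.trans ht.1.le, ht.2.le.trans (hmem (s + 1) (by lia)).2⟩
  have huniq : ∀ j j' t, t ∈ S j → t ∈ S j' → j = j' := by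
    have hlt : ∀ s s', s ≤ M → s' ≤ M → x s < x s' → s < s' :=
      fun s s' hs hs' h => (hx.lt_iff_lt hs hs').1 h
    rintro (s | s) (s' | s') t ht ht'
    · have : x s = x s' := (show t = x s from ht).symm.trans ht'
      exact congrArg _ (Fin.ext (hx.injOn (show (s : ℕ) ≤ M by lia) (show (s' : ℕ) ≤ M by lia)
        this))
    · rw [show t = x s from ht] at ht'
      have h1 := hlt s' s (by lia) (by lia) ht'.1
      have h2 := hlt s (s' + 1) (by lia) (by lia) ht'.2
      lia
    · rw [show t = x s' from ht'] at ht
      have h1 := hlt s s' (by lia) (by lia) ht.1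
      have h2 := hlt s' (s + 1) (by lia) (by lia) ht.2
      lia
    · have h1 := hlt s (s' + 1) (by lia) (by lia) (ht.1.trans ht'.2)
      have h2 := hlt s' (s + 1) (by lia) (by lia) (ht'.1.trans ht.2)
      exact congrArg _ (Fin.ext (by lia))
  have hcov : ∀ N ≤ M, ∀ t ∈ Set.Icc p (x N), ∃ j, t ∈ S j := by
    intro N
    induction N with
    | zero =>
      intro _ t ht
      refine ⟨Sum.inl 0, ?_⟩
      rw [hx0] at ht
      exact (le_antisymm ht.2 ht.1).trans hx0.symm
    | succ N ih =>
      intro hN t ht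
      rcases le_or_gt t (x N) with h | h
      · exact ih (by lia) t ⟨ht.1, h⟩
      · rcases ht.2.lt_or_eq with h' | h'
        · exact ⟨Sum.inr ⟨N, by lia⟩, h, h'⟩
        · exact ⟨Sum.inl ⟨N + 1, by lia⟩, h'⟩
  rw [constructibleIntegral_eq_sum Set.univ k (fun j => γ '' S j)
    (Sum.elim (fun _ => 0) (fun _ => 1)) (Sum.elim (fun s => K (x s)) (fun s => w s))]
  · simp only [Fintype.sum_sum_type, Sum.elim_inl, Sum.elim_inr, pow_zero, pow_one, mul_one,
      mul_neg, Finset.sum_neg_distrib, ← sub_eq_add_neg]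
    rw [Fin.sum_univ_eq_sum_range (fun s => K (x s)), Fin.sum_univ_eq_sum_range w]
  · rintro (s | s)
    · simpa [S] using isCell_singleton (γ (x s))
    · exact hγ.isCell _ _ (hap.le.trans (hmem s (by lia)).1)
        (hx (show (s : ℕ) ≤ M by lia) (show (s : ℕ) + 1 ≤ M by lia) (Nat.lt_succ_self _))
        ((hmem (s + 1) (by lia)).2.trans hqb.le)
  · intro j j' hjj
    refine Set.disjoint_left.2 ?_
    rintro _ ⟨t, ht, rfl⟩ ⟨t', ht', h⟩
    rw [hγ.injOn (hIcc (hSI _ ht')) (hIcc (hSI _ ht)) h] at ht'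
    exact hjj (huniq _ _ t ht ht')
  · rintro j _ ⟨t, ht, rfl⟩
    refine ⟨hsub (Set.mem_image_of_mem γ (hSI j ht)), trivial, ?_⟩
    rw [hk _ t (hSI j ht) rfl]
    rcases j with s | s
    · exact congrArg K ht
    · exact hw s s.2 t ht
  · intro y _ hy
    by_contra hne
    refine hy (hk0 y ?_)
    rintro ⟨t, ht, hty⟩
    obtain ⟨j, hj⟩ := hcov M le_rfl t (hxM.symm ▸ ht)
    exact hne ⟨j, t, hj, hty⟩

/-- The subdivision of `[p, q]` by the points `p + s / N`, on whose pieces `⌊N (t - p)⌋` and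
`⌈N (t - p)⌉` are constant. The last piece may be shorter than the others. -/
lemma exists_subdivision (hpq : p < q) {N : ℝ} (hN : 0 < N) :
    ∃ (M : ℕ) (x : ℕ → ℝ), x 0 = p ∧ x M = q ∧ StrictMonoOn x (Set.Iic M) ∧
      (M : ℤ) = ⌈N * (q - p)⌉ ∧ (∀ s < M, N * (x s - p) = s) ∧
      ∀ s < M, ∀ t ∈ Set.Ioo (x s) (x (s + 1)), ⌊N * (t - p)⌋ = s ∧ ⌈N * (t - p)⌉ = s + 1 := by
  have hpos : 0 < N * (q - p) := mul_pos hN (sub_pos.2 hpq)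
  set M := ⌈N * (q - p)⌉₊ with hM
  have hlt : ∀ s < M, p + s / N < q := by
    intro s hs
    have : (s : ℝ) < N * (q - p) := Nat.lt_ceil.1 hs
    have : (s : ℝ) / N < q - p := by rwa [div_lt_iff₀' hN]
    linarith
  have hle : q ≤ p + M / N := by
    have : N * (q - p) ≤ M := Nat.le_ceil _
    have : q - p ≤ (M : ℝ) / N := by rwa [le_div_iff₀' hN]
    linarith
  have hx : ∀ s < M, min (p + (s : ℝ) / N) q = p + s / N := fun s hs => min_eq_left (hlt s hs).le
  refine ⟨M, fun s => min (p + s / N) q, ?_, min_eq_right hle, ?_, ?_, ?_, ?_⟩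
  · simp [hpq.le]
  · intro s hs s' hs' hss
    have h1 : s < M := lt_of_lt_of_le hss hs'
    simp only [hx s h1]
    refine lt_min ?_ (hlt s h1)
    gcongr
  · rw [hM]
    exact Int.natCast_ceil_eq_ceil hpos.le
  · intro s hs
    simp only [hx s hs]
    field_simp
    ring
  · intro s hs t ht
    simp only [hx s hs] at ht
    have h1 : (s : ℝ) < N * (t - p) := by
      rw [← div_lt_iff₀' hN]; linarith [ht.1]
    have h2 : N * (t - p) < s + 1 := by
      rw [← lt_div_iff₀' hN]
      have := ht.2.trans_le (min_le_left _ _)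
      push_cast at this
      linarith
    constructor
    · rw [Int.floor_eq_iff]
      exact ⟨by exact_mod_cast h1.le, by exact_mod_cast h2⟩
    · rw [Int.ceil_eq_iff]
      push_cast
      exact ⟨by linarith, h2.le⟩

/-- The half-open pieces `{⌊N (t - p)⌋ = s}` of the arc have Euler characteristic zero, except the
last one, which contains the end `q`. -/
lemma IsArc.constructibleIntegral_floor (hγ : O.IsArc γ i a b) (hap : a < p) (hqb : q < b)
    (hpq : p < q) (hsub : γ '' Set.Icc p q ⊆ X) {k : X → ℤ} {N : ℝ} (hN : 0 < N) (α β : ℤ)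
    (hk : ∀ x : X, ∀ t ∈ Set.Icc p q, x.1 = γ t → k x = α + β * ⌊N * (t - p)⌋)
    (hk0 : ∀ x : X, x.1 ∉ γ '' Set.Icc p q → k x = 0) :
    O.constructibleIntegral Set.univ k = α + β * ⌊N * (q - p)⌋ := by
  obtain ⟨M, x, hx0, hxM, hx, -, hgrid, hpiece⟩ := exists_subdivision hpq hN
  rw [hγ.constructibleIntegral_eq hap hqb hsub hk hk0 hx0 hxM hx (w := fun s => α + β * s)
    fun s hs t ht => by rw [(hpiece s hs t ht).1], Finset.sum_range_succ, hxM]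
  have : ∀ s ∈ Finset.range M, α + β * ⌊N * (x s - p)⌋ = α + β * s := by
    intro s hs
    rw [hgrid s (Finset.mem_range.1 hs)]
    simp
  rw [Finset.sum_congr rfl this]
  ring

/-- The half-open pieces `{⌈N (t - p)⌉ = s}` of the arc, `s > 0`, have Euler characteristic zero. -/
lemma IsArc.constructibleIntegral_ceil (hγ : O.IsArc γ i a b) (hap : a < p) (hqb : q < b)
    (hpq : p < q) (hsub : γ '' Set.Icc p q ⊆ X) {k : X → ℤ} {N : ℝ} (hN : 0 < N) (α β : ℤ)
    (hk : ∀ x : X, ∀ t ∈ Set.Icc p q, x.1 = γ t → k x = α + β * ⌈N * (t - p)⌉)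
    (hk0 : ∀ x : X, x.1 ∉ γ '' Set.Icc p q → k x = 0) :
    O.constructibleIntegral Set.univ k = α := by
  obtain ⟨M, x, hx0, hxM, hx, hM, hgrid, hpiece⟩ := exists_subdivision hpq hN
  rw [hγ.constructibleIntegral_eq hap hqb hsub hk hk0 hx0 hxM hx (w := fun s => α + β * (s + 1))
    fun s hs t ht => by rw [(hpiece s hs t ht).2], Finset.sum_range_succ, hxM]
  have : ∀ s ∈ Finset.range M, α + β * ⌈N * (x s - p)⌉ = α + β * (s + 1) - β := by
    intro s hs
    rw [hgrid s (Finset.mem_range.1 hs)]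
    simp
    ring
  rw [Finset.sum_congr rfl this, ← hM, Finset.sum_sub_distrib]
  simp
  ring

/-! ### Integrals of real-valued functions -/

lemma finite_image_rounding {α : Type*} {r : ℝ → ℤ} (hr : r = Int.floor ∨ r = Int.ceil)
    {h : α → ℝ} {B : ℝ} (hB : ∀ x, |h x| ≤ B) (A : Set α) (N : ℕ) :
    ((fun x => r (N * h x)) '' A).Finite := by
  have hmono : Monotone r := by
    rcases hr with rfl | rfl
    exacts [Int.floor_mono, Int.ceil_mono]
  refine (Set.finite_Icc (r (N * -B)) (r (N * B))).subset ?_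
  rintro _ ⟨x, -, rfl⟩
  have := abs_le.1 (hB x)
  exact ⟨hmono (by gcongr; exact this.1), hmono (by gcongr; exact this.2)⟩

lemma tendsto_rounding {r : ℝ → ℤ} (hr : r = Int.floor ∨ r = Int.ceil) (m : ℤ) (y : ℝ) :
    Tendsto (fun n : ℕ => (1 / (n : ℝ)) * ((n * m + r (n * y) : ℤ) : ℝ)) atTop (𝓝 (m + y)) := by
  have hclose : ∀ z, |(r z : ℝ) - z| ≤ 1 := by
    intro z
    rw [abs_le]
    rcases hr with rfl | rfl
    · constructor <;> linarith [Int.floor_le z, Int.lt_floor_add_one z]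
    · constructor <;> linarith [Int.le_ceil z, Int.ceil_lt_add_one z]
  rw [tendsto_iff_norm_sub_tendsto_zero]
  refine squeeze_zero' (Eventually.of_forall fun _ => norm_nonneg _) ?_
    tendsto_one_div_atTop_nhds_zero_nat
  filter_upwards [eventually_gt_atTop 0] with n hn
  have hn' : (0 : ℝ) < n := by exact_mod_cast hn
  have : (1 / (n : ℝ)) * ((n * m + r (n * y) : ℤ) : ℝ) - (m + y)
      = 1 / n * ((r (n * y) : ℝ) - n * y) := by
    push_cast
    field_simp
    ring
  rw [this, norm_mul, Real.norm_eq_abs, Real.norm_eq_abs, abs_of_pos (by positivity)]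
  exact mul_le_of_le_one_right (by positivity) (hclose _)

/-- If the Euler integrals of `r (n h)` over `A` are `n m + r' (n y)`, with `r'` one of the two
roundings, then the integral of `h` is `m + y`. -/
lemma hasIntegral_of_constructibleIntegral_eq {r r' : ℝ → ℤ} (hr : r = Int.floor ∨ r = Int.ceil)
    (hr' : r' = Int.floor ∨ r' = Int.ceil) {A : Set X} {h : X → ℝ} {B : ℝ} (hB : ∀ x, |h x| ≤ B)
    {m : ℤ} {y c : ℝ} (hc : c = m + y) (hI : ∀ n : ℕ, 0 < n →
      O.constructibleIntegral A (fun x => r (n * h x)) = n * m + r' (n * y)) :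
    O.HasIntegral r A h c := by
  refine ⟨finite_image_rounding hr hB A, ?_⟩
  rw [hc]
  refine (tendsto_rounding hr' m y).congr' ?_
  filter_upwards [eventually_gt_atTop 0] with n hn
  rw [hI n hn]

lemma rounding_zero {r : ℝ → ℤ} (hr : r = Int.floor ∨ r = Int.ceil) : r 0 = 0 := by
  rcases hr with rfl | rfl <;> simp

lemma rounding_arcFun_of_notMem {r : ℝ → ℤ} (hr : r = Int.floor ∨ r = Int.ceil) (φ : ℝ → ℝ)
    (N : ℝ) (x : X) (hx : x.1 ∉ γ '' Set.Icc p q) : r (N * arcFun X γ i p q φ x) = 0 := by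
  rw [arcFun_of_notMem φ hx, mul_zero, rounding_zero hr]

lemma abs_affine_le (m : ℤ) :
    ∀ t ∈ Set.Icc p q, |m + (t - p)| ≤ |(m : ℝ)| + (q - p) ∧
      |m - (t - p)| ≤ |(m : ℝ)| + (q - p) := by
  intro t ht
  have h : |t - p| ≤ q - p := by
    rw [abs_of_nonneg (by linarith [ht.1])]; linarith [ht.2]
  exact ⟨(abs_add_le _ _).trans (by linarith), (abs_sub _ _).trans (by linarith)⟩

lemma IsArc.hasIntegral_floor_increasing (hγ : O.IsArc γ i a b) (hap : a < p) (hqb : q < b)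
    (hpq : p < q) (hsub : γ '' Set.Icc p q ⊆ X) (m : ℤ) :
    O.HasIntegral Int.floor Set.univ (arcFun X γ i p q fun t => m + (t - p)) (m + (q - p)) := by
  refine hasIntegral_of_constructibleIntegral_eq (.inl rfl) (.inl rfl)
    (hγ.abs_arcFun_le hap hqb (by have := abs_nonneg (m : ℝ); linarith)
      fun t ht => (abs_affine_le m t ht).1) rfl fun n hn => ?_
  have hn' : (0 : ℝ) < n := by exact_mod_cast hn
  rw [hγ.constructibleIntegral_floor hap hqb hpq hsub hn' (n * m) 1 ?_
    (rounding_arcFun_of_notMem (.inl rfl) _ _), one_mul]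
  intro x t ht hx
  rw [hγ.arcFun_apply hap hqb _ ht hx, mul_add, one_mul, ← Int.floor_intCast_add]
  push_cast
  rfl

lemma IsArc.hasIntegral_ceil_increasing (hγ : O.IsArc γ i a b) (hap : a < p) (hqb : q < b)
    (hpq : p < q) (hsub : γ '' Set.Icc p q ⊆ X) (m : ℤ) :
    O.HasIntegral Int.ceil Set.univ (arcFun X γ i p q fun t => m + (t - p)) m := by
  refine hasIntegral_of_constructibleIntegral_eq (.inr rfl) (.inr rfl)
    (hγ.abs_arcFun_le hap hqb (by have := abs_nonneg (m : ℝ); linarith)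
      fun t ht => (abs_affine_le m t ht).1) (add_zero _).symm fun n hn => ?_
  have hn' : (0 : ℝ) < n := by exact_mod_cast hn
  rw [hγ.constructibleIntegral_ceil hap hqb hpq hsub hn' (n * m) 1 ?_
    (rounding_arcFun_of_notMem (.inr rfl) _ _)]
  · simp
  intro x t ht hx
  rw [hγ.arcFun_apply hap hqb _ ht hx, mul_add, one_mul, ← Int.ceil_intCast_add]
  push_cast
  rfl

lemma IsArc.hasIntegral_floor_decreasing (hγ : O.IsArc γ i a b) (hap : a < p) (hqb : q < b)
    (hpq : p < q) (hsub : γ '' Set.Icc p q ⊆ X) (m : ℤ) :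
    O.HasIntegral Int.floor Set.univ (arcFun X γ i p q fun t => m - (t - p)) m := by
  refine hasIntegral_of_constructibleIntegral_eq (.inl rfl) (.inr rfl)
    (hγ.abs_arcFun_le hap hqb (by have := abs_nonneg (m : ℝ); linarith)
      fun t ht => (abs_affine_le m t ht).2) (add_zero _).symm fun n hn => ?_
  have hn' : (0 : ℝ) < n := by exact_mod_cast hn
  rw [hγ.constructibleIntegral_ceil hap hqb hpq hsub hn' (n * m) (-1) ?_
    (rounding_arcFun_of_notMem (.inl rfl) _ _)]
  · simp
  intro x t ht hx
  rw [hγ.arcFun_apply hap hqb _ ht hx, mul_sub, neg_one_mul, ← Int.floor_neg,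
    ← Int.floor_intCast_add, sub_eq_add_neg]
  push_cast
  rfl

lemma IsArc.hasIntegral_ceil_decreasing (hγ : O.IsArc γ i a b) (hap : a < p) (hqb : q < b)
    (hpq : p < q) (hsub : γ '' Set.Icc p q ⊆ X) (m : ℤ) :
    O.HasIntegral Int.ceil Set.univ (arcFun X γ i p q fun t => m - (t - p)) (m - (q - p)) := by
  refine hasIntegral_of_constructibleIntegral_eq (.inr rfl) (.inr rfl)
    (hγ.abs_arcFun_le hap hqb (by have := abs_nonneg (m : ℝ); linarith)
      fun t ht => (abs_affine_le m t ht).2) (sub_eq_add_neg _ _) fun n hn => ?_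
  have hn' : (0 : ℝ) < n := by exact_mod_cast hn
  rw [hγ.constructibleIntegral_floor hap hqb hpq hsub hn' (n * m) (-1) ?_
    (rounding_arcFun_of_notMem (.inr rfl) _ _), mul_neg, Int.ceil_neg, neg_one_mul]
  intro x t ht hx
  rw [hγ.arcFun_apply hap hqb _ ht hx, mul_sub, neg_one_mul, ← Int.ceil_neg,
    ← Int.ceil_intCast_add, sub_eq_add_neg]
  push_cast
  rfl

lemma IsArc.hasIntegral_const (hγ : O.IsArc γ i a b) (hap : a < p) (hqb : q < b)
    (hpq : p < q) (hsub : γ '' Set.Icc p q ⊆ X) {r : ℝ → ℤ} (hr : r = Int.floor ∨ r = Int.ceil)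
    (y : ℝ) : O.HasIntegral r Set.univ (arcFun X γ i p q fun _ => y) y := by
  refine hasIntegral_of_constructibleIntegral_eq (m := 0) (y := y) hr hr
    (hγ.abs_arcFun_le hap hqb (abs_nonneg y) fun t ht => le_rfl) (by simp) fun n hn => ?_
  have hn' : (0 : ℝ) < n := by exact_mod_cast hn
  rw [hγ.constructibleIntegral_floor hap hqb hpq hsub hn' (r (n * y)) 0 ?_
    (rounding_arcFun_of_notMem hr _ _)]
  · simp
  intro x t ht hx
  rw [hγ.arcFun_apply hap hqb _ ht hx]
  simp

/-- The function that is `2 δ` on the half-open first half of the arc, `δ` at its middle `c` and `0`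
after it: the half-open piece does not contribute to its integral. -/
lemma IsArc.hasIntegral_step {c δ : ℝ} (hγ : O.IsArc γ i a b) (hδ : 0 < δ) (hap : a < c - δ)
    (hqb : c + δ < b) (hsub : γ '' Set.Icc (c - δ) (c + δ) ⊆ X) {r : ℝ → ℤ}
    (hr : r = Int.floor ∨ r = Int.ceil) :
    O.HasIntegral r Set.univ (arcFun X γ i (c - δ) (c + δ)
      fun t => if t < c then 2 * δ else if t = c then δ else 0) δ := by
  refine hasIntegral_of_constructibleIntegral_eq (m := 0) (y := δ) hr hr
    (hγ.abs_arcFun_le hap hqb (B := 2 * δ) (by linarith) fun t ht => ?_) (by simp) fun n hn => ?_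
  · split_ifs
    · rw [abs_of_pos (by linarith)]
    · rw [abs_of_pos hδ]; linarith
    · rw [abs_zero]; linarith
  let x : ℕ → ℝ := fun s => c - δ + s * δ
  have hx : StrictMono x := fun s s' h => by
    have : (s : ℝ) < s' := by exact_mod_cast h
    simp only [x]
    gcongr
  rw [hγ.constructibleIntegral_eq hap hqb hsub (x := x) (M := 2)
    (K := fun t => r (n * if t < c then 2 * δ else if t = c then δ else 0))
    (w := fun s => if s = 0 then r (n * (2 * δ)) else 0)
    (fun y t ht hy => by rw [hγ.arcFun_apply hap hqb _ ht hy])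
    (rounding_arcFun_of_notMem hr _ _) (by simp [x]) (by simp only [x]; push_cast; ring)
    (hx.strictMonoOn _)]
  · have h0 : x 0 < c := by simp [x, hδ]
    have h1 : x 1 = c := by simp [x]
    have h2 : c < x 2 := by simp only [x]; push_cast; linarith
    simp [Finset.sum_range_succ, h0, h1, h2.not_gt, h2.ne', rounding_zero hr]
  · intro s hs t ht
    simp only [x, Set.mem_Ioo] at ht
    interval_cases s
    · have : t < c := by have := ht.2; push_cast at this; linarith
      simp [this]
    · have : c < t := by have := ht.1; push_cast at this; linarith
      simp [this.not_gt, this.ne', rounding_zero hr]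

end Arc

/-- The integral over a finite set is the sum of the values. -/
lemma hasIntegral_finset {n : ℕ} {X : Set (Fin n → ℝ)} {r : ℝ → ℤ}
    (hr : r = Int.floor ∨ r = Int.ceil) (A : Finset X) (h : X → ℝ) :
    O.HasIntegral r (A : Set X) h (∑ x ∈ A, h x) := by
  refine ⟨fun N => A.finite_toSet.image _, ?_⟩
  have key : ∀ k : X → ℤ, O.constructibleIntegral (A : Set X) k = ∑ x ∈ A, k x := by
    intro k
    rw [constructibleIntegral_eq_sum (A : Set X) k (fun x : A => {x.1.1}) (fun _ => 0)
      (fun x => k x.1) (fun x => isCell_singleton _)]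
    · rw [← Finset.sum_coe_sort A k]
      exact Finset.sum_congr rfl fun x _ => mul_one _
    · intro x y hxy
      exact Set.disjoint_singleton.2 fun e => hxy (Subtype.ext (Subtype.ext e))
    · rintro ⟨x, hx⟩ _ rfl
      exact ⟨x.2, hx, rfl⟩
    · intro x hx _
      exact ⟨⟨x, hx⟩, rfl⟩
  simp only [key, Int.cast_sum, Finset.mul_sum]
  refine tendsto_finsetSum _ fun x _ => ?_
  simpa using tendsto_rounding hr 0 (h x)

/-! ### Failure of additivity and of the Fubini theorem -/

section Arc

variable {n : ℕ} {γ : ℝ → Fin n → ℝ} {i : Fin n} {a b p q : ℝ} {X : Set (Fin n → ℝ)}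

lemma IsArc.arcFun_increasing_mem_Def (hadd : O.Definable {x : Fin 3 → ℝ | x 0 + x 1 = x 2})
    (hγ : O.IsArc γ i a b) (hap : a < p) (hqb : q < b) (hX : O.Definable X)
    (hsub : γ '' Set.Icc p q ⊆ X) (m : ℤ) :
    (arcFun X γ i p q fun t => m + (t - p)) ∈ O.Def X := by
  refine hγ.arcFun_mem_Def hap hqb hX hsub ?_
  convert Definable.inter (definable_coord_Icc 0 p q) (definable_coord_eq_add hadd 1 0 (m - p))
    using 1
  ext v
  simp only [Set.mem_ofPred_eq, Set.mem_inter_iff]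
  exact and_congr_right fun _ => ⟨fun h => by linarith, fun h => by linarith⟩

lemma IsArc.arcFun_decreasing_mem_Def (hadd : O.Definable {x : Fin 3 → ℝ | x 0 + x 1 = x 2})
    (hγ : O.IsArc γ i a b) (hap : a < p) (hqb : q < b) (hX : O.Definable X)
    (hsub : γ '' Set.Icc p q ⊆ X) (m : ℤ) :
    (arcFun X γ i p q fun t => m - (t - p)) ∈ O.Def X := by
  refine hγ.arcFun_mem_Def hap hqb hX hsub ?_
  convert Definable.inter (definable_coord_Icc 0 p q) (definable_coord_add_eq hadd 0 1 (m + p))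
    using 1
  ext v
  simp only [Set.mem_ofPred_eq, Set.mem_inter_iff]
  exact and_congr_right fun _ => ⟨fun h => by linarith, fun h => by linarith⟩

lemma IsArc.arcFun_const_mem_Def (hγ : O.IsArc γ i a b) (hap : a < p) (hqb : q < b)
    (hX : O.Definable X) (hsub : γ '' Set.Icc p q ⊆ X) (y : ℝ) :
    (arcFun X γ i p q fun _ => y) ∈ O.Def X :=
  hγ.arcFun_mem_Def hap hqb hX hsub
    (Definable.inter (definable_coord_Icc 0 p q) (definable_coord_eq 1 y))

lemma IsArc.arcFun_step_mem_Def (hγ : O.IsArc γ i a b) (hap : a < p) (hqb : q < b)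
    (hX : O.Definable X) (hsub : γ '' Set.Icc p q ⊆ X) (c y z : ℝ) :
    (arcFun X γ i p q fun t => if t < c then y else if t = c then z else 0) ∈ O.Def X := by
  refine hγ.arcFun_mem_Def hap hqb hX hsub (Definable.inter (definable_coord_Icc 0 p q) ?_)
  change O.Definable {v : Fin 2 → ℝ | v 1 = if v 0 < c then y else if v 0 = c then z else 0}
  convert O.union (Definable.inter (definable_coord_lt 0 c) (definable_coord_eq 1 y))
    (O.union (Definable.inter (definable_coord_eq 0 c) (definable_coord_eq 1 z))
      (Definable.inter (definable_lt_coord 0 c) (definable_coord_eq (n := 2) 1 0))) using 1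
  ext v
  simp only [Set.mem_ofPred_eq, Set.mem_inter_iff, Set.mem_union]
  rcases lt_trichotomy (v 0) c with h | h | h
  · simp [h, h.ne, h.not_gt]
  · simp [h]
  · simp [h, h.ne', h.not_gt]

/-- On a definable set that contains an arc, the sum of a monotone function supported on a compact
piece of the arc and its negative has integral `0`, unlike the sum of the two integrals: with
respect to `⌊dχ⌋` these are the length of the parameter interval and `0`. -/
lemma IsArc.exists_integral_add_ne (hadd : O.Definable {x : Fin 3 → ℝ | x 0 + x 1 = x 2})
    (hγ : O.IsArc γ i a b) (hX : O.Definable X) (hsub : γ '' Set.Ioo a b ⊆ X) {r : ℝ → ℤ}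
    (hr : r = Int.floor ∨ r = Int.ceil) :
    ∃ f g : X → ℝ, f ∈ O.Def X ∧ g ∈ O.Def X ∧ f + g ∈ O.Def X ∧
      ∃ a b c : ℝ, O.HasIntegral r Set.univ f a ∧ O.HasIntegral r Set.univ g b ∧
        O.HasIntegral r Set.univ (f + g) c ∧ c ≠ a + b := by
  obtain ⟨p, hap, hpb⟩ := exists_between hγ.lt
  obtain ⟨q, hpq, hqb⟩ := exists_between hpb
  have hs : γ '' Set.Icc p q ⊆ X :=
    (Set.image_mono (Icc_subset_Ioo_of_lt hap hqb)).trans hsub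
  have hfg : (arcFun X γ i p q fun t => (0 : ℤ) + (t - p)) +
      (arcFun X γ i p q fun t => (0 : ℤ) - (t - p)) = arcFun X γ i p q fun _ => 0 := by
    funext x
    by_cases hx : x.1 ∈ γ '' Set.Icc p q <;> simp [arcFun, hx]
  refine ⟨_, _, hγ.arcFun_increasing_mem_Def hadd hap hqb hX hs 0,
    hγ.arcFun_decreasing_mem_Def hadd hap hqb hX hs 0, ?_, ?_⟩
  · rw [hfg]
    exact hγ.arcFun_const_mem_Def hap hqb hX hs 0
  · rw [hfg]
    rcases hr with rfl | rfl
    · refine ⟨_, _, _, hγ.hasIntegral_floor_increasing hap hqb hpq hs 0,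
        hγ.hasIntegral_floor_decreasing hap hqb hpq hs 0,
        hγ.hasIntegral_const hap hqb hpq hs (.inl rfl) 0, ?_⟩
      push_cast
      intro h
      linarith
    · refine ⟨_, _, _, hγ.hasIntegral_ceil_increasing hap hqb hpq hs 0,
        hγ.hasIntegral_ceil_decreasing hap hqb hpq hs 0,
        hγ.hasIntegral_const hap hqb hpq hs (.inr rfl) 0, ?_⟩
      push_cast
      intro h
      linarith

/-- Over a definable set that contains an arc, the Fubini theorem fails for the map that folds the
arc `γ [c - δ, c + δ]` at its middle `γ c` and for the function `h (γ t) = t - (c - δ)`. The points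
`γ t` and `γ (2 c - t)` of a fibre contribute `2 δ` together, the middle contributes `δ`, and so the
integral of the pushforward is `δ`, whereas that of `h` is `2 δ` or `0`. -/
lemma IsArc.exists_fubini_ne (hadd : O.Definable {x : Fin 3 → ℝ | x 0 + x 1 = x 2})
    (hγ : O.IsArc γ i a b) {Y : Set (Fin n → ℝ)} (hY : O.Definable Y)
    (hsub : γ '' Set.Ioo a b ⊆ Y) {r : ℝ → ℤ} (hr : r = Int.floor ∨ r = Int.ceil) :
    ∃ (k : ℕ) (X : Set (Fin k → ℝ)) (F : X → Y) (h : X → ℝ) (H : Y → ℝ),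
      O.Definable X ∧ O.DefinableMap (fun x => (F x : Fin n → ℝ)) ∧
      h ∈ O.Def X ∧ H ∈ O.Def Y ∧
      (∀ y : Y, O.HasIntegral r {x : X | F x = y} h (H y)) ∧
      ∃ a b : ℝ, O.HasIntegral r Set.univ h a ∧ O.HasIntegral r Set.univ H b ∧ a ≠ b := by
  classical
  obtain ⟨c, hac, hcb⟩ := exists_between hγ.lt
  obtain ⟨δ, hδ, hδm⟩ := exists_between (lt_min (sub_pos.2 hac) (sub_pos.2 hcb))
  have hap : a < c - δ := by linarith [hδm.trans_le (min_le_left _ _)]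
  have hqb : c + δ < b := by linarith [hδm.trans_le (min_le_right _ _)]
  have hpq : c - δ < c + δ := by linarith
  have hI := Icc_subset_Ioo_of_lt hap hqb
  have hs : γ '' Set.Icc (c - δ) (c + δ) ⊆ Y := (Set.image_mono hI).trans hsub
  have hX := hγ.definable_image_Icc hap hqb
  -- the folding map of the parameter interval
  let fold : ℝ → ℝ := fun t => if t ≤ c then t else 2 * c - t
  have hfold : ∀ t ∈ Set.Icc (c - δ) (c + δ), fold t ∈ Set.Icc (c - δ) (c + δ) := by
    intro t ht
    simp only [fold]
    split_ifs with h
    · exact ht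
    · rw [not_le] at h
      exact ⟨by linarith [ht.2], by linarith⟩
  have hcoord : ∀ x ∈ γ '' Set.Icc (c - δ) (c + δ), x i ∈ Set.Icc (c - δ) (c + δ) := by
    intro x hx
    rw [hγ.image_Icc hap hqb] at hx
    exact hx.2
  let F : γ '' Set.Icc (c - δ) (c + δ) → Y := fun x =>
    ⟨γ (fold (x.1 i)), hs (Set.mem_image_of_mem γ (hfold _ (hcoord x.1 x.2)))⟩
  let h := arcFun (γ '' Set.Icc (c - δ) (c + δ)) γ i (c - δ) (c + δ)
    fun t => (0 : ℤ) + (t - (c - δ))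
  let pt : ∀ t ∈ Set.Icc (c - δ) (c + δ), γ '' Set.Icc (c - δ) (c + δ) :=
    fun t ht => ⟨γ t, Set.mem_image_of_mem γ ht⟩
  have hh : ∀ t ht, h (pt t ht) = t - (c - δ) := by
    intro t ht
    simp only [h]
    rw [hγ.arcFun_apply hap hqb _ ht rfl]
    simp
  have hpt : ∀ t ht t' ht', pt t ht = pt t' ht' ↔ t = t' := by
    intro t ht t' ht'
    rw [Subtype.ext_iff]
    exact ⟨fun e => hγ.injOn (hI ht) (hI ht') e, fun e => e ▸ rfl⟩
  refine ⟨n, γ '' Set.Icc (c - δ) (c + δ), F, h,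
    arcFun Y γ i (c - δ) (c + δ) fun t => if t < c then 2 * δ else if t = c then δ else 0,
    hX, ?_, hγ.arcFun_increasing_mem_Def hadd hap hqb hX le_rfl 0,
    hγ.arcFun_step_mem_Def hap hqb hY hs c _ _, ?_, ?_⟩
  · have h1 := hX.preimage_comp (Fin.castAdd n : Fin n → Fin (n + n))
    have h2 := hX.preimage_comp (Fin.natAdd n : Fin n → Fin (n + n))
    have h3 := O.union
      (Definable.inter (O.compl (definable_lt_coord (Fin.castAdd n i) c))
        (O.diag (Fin.castAdd n i) (Fin.natAdd n i)))
      (Definable.inter (definable_lt_coord (Fin.castAdd n i) c)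
        (definable_coord_add_eq hadd (Fin.castAdd n i) (Fin.natAdd n i) (2 * c)))
    unfold DefinableMap
    convert Definable.inter (Definable.inter h1 h2) h3 using 1
    ext z
    simp only [Set.mem_ofPred_eq, Set.mem_inter_iff, Set.mem_union, Set.mem_compl_iff, not_lt]
    have hiff : (z (Fin.castAdd n i) ≤ c ∧ z (Fin.castAdd n i) = z (Fin.natAdd n i) ∨
        c < z (Fin.castAdd n i) ∧ z (Fin.castAdd n i) + z (Fin.natAdd n i) = 2 * c) ↔
        z (Fin.natAdd n i) = fold (z (Fin.castAdd n i)) := by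
      simp only [fold]
      rcases le_or_gt (z (Fin.castAdd n i)) c with hz | hz
      · simp only [hz, hz.not_gt, true_and, false_and, or_false, if_true]
        exact eq_comm
      · simp only [hz, hz.not_ge, true_and, false_and, false_or, if_false]
        exact ⟨fun e => by linarith, fun e => by linarith⟩
    rw [hiff]
    constructor
    · rintro ⟨hx, hz⟩
      have hf := hfold _ (hcoord _ hx)
      refine ⟨⟨hx, ?_⟩, ?_⟩
      · rw [hz]
        exact Set.mem_image_of_mem γ hf
      · exact (congrFun hz i).trans (hγ.coord _ (hI hf))
    · rintro ⟨⟨hx, t, ht, hz⟩, hzi⟩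
      refine ⟨hx, ?_⟩
      have : z (Fin.natAdd n i) = t := (congrFun hz i).symm.trans (hγ.coord _ (hI ht))
      rw [← hz, ← this, hzi]
  · intro y
    -- the fibre over `γ s` consists of the points `γ t` with `fold t = s`
    have hFpt : ∀ t ht s, s ∈ Set.Icc (c - δ) (c + δ) → y.1 = γ s →
        (F (pt t ht) = y ↔ fold t = s) := by
      intro t ht s hs' hys
      rw [Subtype.ext_iff, hys]
      simp only [F, pt, hγ.coord t (hI ht)]
      exact ⟨fun e => hγ.injOn (hI (hfold t ht)) (hI hs') e, fun e => e ▸ rfl⟩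
    have hsurj : ∀ x : γ '' Set.Icc (c - δ) (c + δ), ∃ t ht, x = pt t ht := by
      rintro ⟨_, t, ht, rfl⟩
      exact ⟨t, ht, rfl⟩
    by_cases hy : y.1 ∈ γ '' Set.Icc (c - δ) (c + δ)
    · obtain ⟨s, hsI, hys⟩ := hy
      rw [hγ.arcFun_apply hap hqb _ hsI hys.symm]
      rcases lt_trichotomy s c with hsc | hsc | hsc
      · have hs' : 2 * c - s ∈ Set.Icc (c - δ) (c + δ) :=
          ⟨by linarith, by linarith [hsI.1]⟩
        have hne : pt s hsI ≠ pt _ hs' := fun e => by linarith [(hpt s hsI _ hs').1 e]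
        convert hasIntegral_finset hr {pt s hsI, pt _ hs'} h using 1
        · ext x
          obtain ⟨t, ht, rfl⟩ := hsurj x
          rw [Set.mem_ofPred_eq, hFpt t ht s hsI hys.symm]
          simp only [Finset.coe_insert, Finset.coe_singleton, Set.mem_insert_iff,
            Set.mem_singleton_iff, hpt, fold]
          split_ifs with htc
          · exact ⟨Or.inl, fun e => e.resolve_right fun e => by linarith⟩
          · rw [not_le] at htc
            exact ⟨fun e => Or.inr (by linarith), fun e => by rcases e with e | e <;> linarith⟩
        · rw [Finset.sum_pair hne, hh s hsI, hh _ hs', if_pos hsc]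
          ring
      · subst hsc
        convert hasIntegral_finset hr {pt s hsI} h using 1
        · ext x
          obtain ⟨t, ht, rfl⟩ := hsurj x
          rw [Set.mem_ofPred_eq, hFpt t ht s hsI hys.symm]
          simp only [Finset.coe_singleton, Set.mem_singleton_iff, hpt, fold]
          split_ifs with htc
          · rfl
          · exact ⟨fun e => by linarith, fun e => by linarith⟩
        · rw [Finset.sum_singleton, hh s hsI]
          simp
      · convert hasIntegral_finset hr ∅ h using 1
        · ext x
          obtain ⟨t, ht, rfl⟩ := hsurj x
          rw [Set.mem_ofPred_eq, hFpt t ht s hsI hys.symm]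
          simp only [Finset.coe_empty, Set.mem_empty_iff_false, iff_false, fold]
          split_ifs with htc <;> intro e <;> linarith
        · simp [hsc.not_gt, hsc.ne']
    · rw [arcFun_of_notMem _ hy]
      convert hasIntegral_finset hr ∅ h using 1
      · ext x
        simp only [Set.mem_ofPred_eq, Finset.coe_empty, Set.mem_empty_iff_false, iff_false]
        rintro rfl
        exact hy (Set.mem_image_of_mem γ (hfold _ (hcoord x.1 x.2)))
      · simp
  · rcases hr with rfl | rfl
    · refine ⟨_, _, hγ.hasIntegral_floor_increasing hap hqb hpq le_rfl 0,
        hγ.hasIntegral_step hδ hap hqb hs (.inl rfl), ?_⟩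
      push_cast
      intro e
      linarith
    · refine ⟨_, _, hγ.hasIntegral_ceil_increasing hap hqb hpq le_rfl 0,
        hγ.hasIntegral_step hδ hap hqb hs (.inr rfl), ?_⟩
      push_cast
      exact hδ.ne

end Arc

/-! ### The unit interval -/

lemma isArc_line : O.IsArc (fun t (_ : Fin 1) => t) 0 (-1) 2 := by
  have h := isArc_snoc (O := O) (Fin.elim0 : Fin 0 → ℝ) (show (-1 : ℝ) < 2 by norm_num)
  convert h using 2 with t
  ext j
  fin_cases j
  rfl

lemma image_line_Icc : (fun (t : ℝ) (_ : Fin 1) => t) '' Set.Icc 0 1 = unitSegment := by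
  ext x
  constructor
  · rintro ⟨t, ht, rfl⟩
    exact ht
  · intro hx
    exact ⟨x 0, hx, by ext j; fin_cases j; rfl⟩

lemma arcFun_unitSegment (φ : ℝ → ℝ) :
    arcFun unitSegment (fun t _ => t) 0 0 1 φ = fun x => φ (x.1 0) := by
  funext x
  exact if_pos (image_line_Icc.symm ▸ x.2)

lemma unitSegment_example (hadd : O.Definable {x : Fin 3 → ℝ | x 0 + x 1 = x 2}) :
    O.Definable unitSegment ∧
      (fun _ => 1) ∈ O.Def unitSegment ∧
      (fun x => x.1 0) ∈ O.Def unitSegment ∧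
      (fun x => 1 - x.1 0) ∈ O.Def unitSegment ∧
      O.HasIntegral Int.floor (X := unitSegment) Set.univ (fun _ => 1) 1 ∧
      O.HasIntegral Int.floor (X := unitSegment) Set.univ (fun x => x.1 0) 1 ∧
      O.HasIntegral Int.floor (X := unitSegment) Set.univ (fun x => 1 - x.1 0) 1 ∧
      O.HasIntegral Int.ceil (X := unitSegment) Set.univ (fun _ => 1) 1 ∧
      O.HasIntegral Int.ceil (X := unitSegment) Set.univ (fun x => x.1 0) 0 ∧
      O.HasIntegral Int.ceil (X := unitSegment) Set.univ (fun x => 1 - x.1 0) 0 := by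
  have hγ := isArc_line (O := O)
  have h0 : (-1 : ℝ) < 0 := by norm_num
  have h1 : (1 : ℝ) < 2 := by norm_num
  have hs := image_line_Icc.le
  have hX : O.Definable unitSegment := image_line_Icc ▸ hγ.definable_image_Icc h0 h1
  have e1 := arcFun_unitSegment fun _ => 1
  have e2 : arcFun unitSegment (fun t _ => t) 0 0 1 (fun t => (0 : ℤ) + (t - 0))
      = fun x => x.1 0 := by simpa using arcFun_unitSegment fun t => (0 : ℤ) + (t - 0)
  have e3 : arcFun unitSegment (fun t _ => t) 0 0 1 (fun t => (1 : ℤ) - (t - 0))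
      = fun x => 1 - x.1 0 := by simpa using arcFun_unitSegment fun t => (1 : ℤ) - (t - 0)
  rw [← e1, ← e2, ← e3]
  refine ⟨hX, hγ.arcFun_const_mem_Def h0 h1 hX hs 1,
    hγ.arcFun_increasing_mem_Def hadd h0 h1 hX hs 0,
    hγ.arcFun_decreasing_mem_Def hadd h0 h1 hX hs 1,
    hγ.hasIntegral_const h0 h1 one_pos hs (.inl rfl) 1, ?_, ?_,
    hγ.hasIntegral_const h0 h1 one_pos hs (.inr rfl) 1, ?_, ?_⟩
  · simpa using hγ.hasIntegral_floor_increasing h0 h1 one_pos hs 0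
  · simpa using hγ.hasIntegral_floor_decreasing h0 h1 one_pos hs 1
  · simpa using hγ.hasIntegral_ceil_increasing h0 h1 one_pos hs 0
  · simpa using hγ.hasIntegral_ceil_decreasing h0 h1 one_pos hs 1

end OMinimalStructure

theorem mainTheorem12 (O : OMinimalStructure)
    (hadd : O.Definable {x : Fin 3 → ℝ | x 0 + x 1 = x 2}) :
    -- on every definable set of positive dimension, neither integral is additive
    (∀ r : ℝ → ℤ, r = Int.floor ∨ r = Int.ceil →
      ∀ (m : ℕ) (X : Set (Fin m → ℝ)), O.Definable X → 0 < O.dim X →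
        ∃ f g : X → ℝ, f ∈ O.Def X ∧ g ∈ O.Def X ∧ f + g ∈ O.Def X ∧
          ∃ a b c : ℝ, O.HasIntegral r Set.univ f a ∧ O.HasIntegral r Set.univ g b ∧
            O.HasIntegral r Set.univ (f + g) c ∧ c ≠ a + b) ∧
    -- the example on the unit interval
    (O.Definable unitSegment ∧
      (fun _ => 1) ∈ O.Def unitSegment ∧
      (fun x => x.1 0) ∈ O.Def unitSegment ∧
      (fun x => 1 - x.1 0) ∈ O.Def unitSegment ∧
      O.HasIntegral Int.floor (X := unitSegment) Set.univ (fun _ => 1) 1 ∧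
      O.HasIntegral Int.floor (X := unitSegment) Set.univ (fun x => x.1 0) 1 ∧
      O.HasIntegral Int.floor (X := unitSegment) Set.univ (fun x => 1 - x.1 0) 1 ∧
      O.HasIntegral Int.ceil (X := unitSegment) Set.univ (fun _ => 1) 1 ∧
      O.HasIntegral Int.ceil (X := unitSegment) Set.univ (fun x => x.1 0) 0 ∧
      O.HasIntegral Int.ceil (X := unitSegment) Set.univ (fun x => 1 - x.1 0) 0) ∧
    -- over every definable set of positive dimension, the Fubini theorem fails
    (∀ r : ℝ → ℤ, r = Int.floor ∨ r = Int.ceil →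
      ∀ (m : ℕ) (Y : Set (Fin m → ℝ)), O.Definable Y → 0 < O.dim Y →
        ∃ (k : ℕ) (X : Set (Fin k → ℝ)) (F : X → Y) (h : X → ℝ) (H : Y → ℝ),
          O.Definable X ∧ O.DefinableMap (fun x => (F x : Fin m → ℝ)) ∧
          h ∈ O.Def X ∧ H ∈ O.Def Y ∧
          (∀ y : Y, O.HasIntegral r {x : X | F x = y} h (H y)) ∧
          ∃ a b : ℝ, O.HasIntegral r Set.univ h a ∧ O.HasIntegral r Set.univ H b ∧ a ≠ b) := by
  refine ⟨fun r hr m X hX hdim => ?_, OMinimalStructure.unitSegment_example hadd,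
    fun r hr m Y hY hdim => ?_⟩
  · obtain ⟨γ, i, a, b, hγ, hsub⟩ := OMinimalStructure.exists_isArc_of_dim_pos hdim
    exact hγ.exists_integral_add_ne hadd hX hsub hr
  · obtain ⟨γ, i, a, b, hγ, hsub⟩ := OMinimalStructure.exists_isArc_of_dim_pos hdim
    exact hγ.exists_fubini_ne hadd hY hsub hr
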